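/- For $\ell\in\tfrac12\mathbb{N}$ and $m,n\in\{-\ell,-\ell+1,\dots,\ell\}$ let $t^\ell_{m,n}\colon SU(2)\to\mathbb{C}$ be the matrix elements of the spin-$\ell$ irreducible representation of $SU(2)$ in its standard basis. Explicitly, $g\in SU(2)$ acts on homogeneous complex polynomials $F$ of degree $2\ell$ in two variables by $(g\cdot F)(x)=F(xg)$, where $x=(x_0,x_1)$ is a row vector; the basis vectors are $\psi^\ell_n=x_0^{\ell-n}x_1^{\ell+n}/\sqrt{(\ell-n)!\,(\ell+n)!}$; and $g\cdot\psi^\ell_n=\sum_{m=-\ell}^{\ell}t^\ell_{m,n}(g)\,\psi^\ell_m$. Let $dg$ be the Haar measure on $SU(2)$ of total mass one. A function $h\colon SU(2)\to\mathbb{C}$ is called $SU(2)$-finite if it is continuous and its left translates span a finite-dimensional complex vector space. Let $f=\sum_{i=1}^3 A_i\,t^{\ell_i}_{m_i,n_i}$, where $A_1,A_2,A_3\in\mathbb{C}$ are all non-zero and the triples $(\ell_i,m_i,n_i)$, $i=1,2,3$, are pairwise distinct. Assume that the matrix $$M=\begin{pmatrix}1&1&1\\ m_1&m_2&m_3\\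 n_1&n_2&n_3\end{pmatrix}$$ has rank different from $2$. Then the Mathieu Conjecture holds for $f$: if $\int_{SU(2)}f(g)^P\,dg=0$ for every integer $P>0$, then for every $SU(2)$-finite function $h$ there is $P_0$ such that $\int_{SU(2)}f(g)^P\,h(g)\,dg=0$ for all integers $P\ge P_0$. -/

import Mathlib

open MeasureTheory Filter

noncomputable section

namespace Mathieu

/-! ### The Mathieu property on a compact group -/

section General

variable {G : Type*} [Group G] [TopologicalSpace G]

/-- A `G`-finite function: a continuous complex-valued function on `G` whose left translates span a
finite-dimensional complex vector space. -/
def IsGFinite (h : G → ℂ) : Prop :=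
  Continuous h ∧
    FiniteDimensional ℂ (Submodule.span ℂ (Set.range fun (a : G) (g : G) => h (a * g)))

/-- The Haar measure of total mass one on a compact group. -/
def normalizedHaar (G : Type*) [Group G] [TopologicalSpace G] [IsTopologicalGroup G]
    [CompactSpace G] [MeasurableSpace G] [BorelSpace G] : Measure G :=
  Measure.haarMeasure (⊤ : TopologicalSpace.PositiveCompacts G)

/-- The assertion of the Mathieu Conjecture for the function `f`: if all powers `f ^ P`, `P > 0`,
integrate to zero, then for every `G`-finite `h` the integral of `f ^ P * h` vanishes for all
sufficiently large `P`. -/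
def MathieuHoldsFor [IsTopologicalGroup G] [CompactSpace G] [MeasurableSpace G] [BorelSpace G]
    (f : G → ℂ) : Prop :=
  (∀ P : ℕ, 0 < P → ∫ g, f g ^ P ∂(normalizedHaar G) = 0) →
    ∀ h : G → ℂ, IsGFinite h → ∀ᶠ P : ℕ in atTop, ∫ g, f g ^ P * h g ∂(normalizedHaar G) = 0

end General

/-! ### The compact group `SU(2)` -/

/-- The group `SU(2)`, with the topology of a subset of the `2 × 2` complex matrices. -/
abbrev SU2 : Type := Matrix.specialUnitaryGroup (Fin 2) ℂ

instance instIsTopologicalGroupSU2 : IsTopologicalGroup SU2 where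
  continuous_mul := continuous_mul
  continuous_inv := by
    refine Continuous.subtype_mk (f := fun A : SU2 => star (A : Matrix (Fin 2) (Fin 2) ℂ)) ?_ _
    exact continuous_star.comp continuous_subtype_val

instance instCompactSpaceSU2 : CompactSpace SU2 := by
  refine isCompact_iff_compactSpace.mp ?_
  have hK : IsCompact (Set.pi Set.univ fun _ : Fin 2 => Set.pi Set.univ fun _ : Fin 2 =>
      Metric.closedBall (0 : ℂ) 1) :=
    isCompact_univ_pi fun _ => isCompact_univ_pi fun _ => isCompact_closedBall _ _
  refine IsCompact.of_isClosed_subset (X := Matrix (Fin 2) (Fin 2) ℂ) hK ?_ ?_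
  · have h1 : IsClosed {A : Matrix (Fin 2) (Fin 2) ℂ | A * star A = 1} :=
      isClosed_eq (continuous_id.mul continuous_star) continuous_const
    have h2 : IsClosed {A : Matrix (Fin 2) (Fin 2) ℂ | A.det = 1} :=
      isClosed_eq (Continuous.matrix_det continuous_id) continuous_const
    convert h1.inter h2 using 1
    ext A
    simp [Matrix.mem_specialUnitaryGroup_iff, Matrix.mem_unitaryGroup_iff]
  · intro A hA i _ j _
    rw [mem_closedBall_zero_iff]
    exact entry_norm_bound_of_unitary (Matrix.mem_specialUnitaryGroup_iff.mp hA).1 i j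

instance instMeasurableSpaceSU2 : MeasurableSpace SU2 := borel SU2

instance instBorelSpaceSU2 : BorelSpace SU2 := ⟨rfl⟩

/-! ### The irreducible representations of `SU(2)` and their matrix elements -/

/-- The representation of `SU(2)` on complex polynomials in two variables by substitution,
`(g • F)(x) = F(x g)` for the row vector `x = (x₀, x₁)`. -/
def polyRep : Representation ℂ SU2 (MvPolynomial (Fin 2) ℂ) where
  toFun g := (MvPolynomial.aeval fun j : Fin 2 =>
    ∑ i : Fin 2, MvPolynomial.C (g.1 i j) * MvPolynomial.X i).toLinearMap
  map_one' := by
    have : (MvPolynomial.aeval fun j : Fin 2 =>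
        ∑ i : Fin 2, MvPolynomial.C ((1 : SU2).1 i j) * MvPolynomial.X i)
        = AlgHom.id ℂ (MvPolynomial (Fin 2) ℂ) := by
      ext j : 1
      fin_cases j <;> simp [Matrix.one_apply]
    rw [this]; rfl
  map_mul' g k := by
    have : (MvPolynomial.aeval fun j : Fin 2 =>
        ∑ i : Fin 2, MvPolynomial.C ((g * k).1 i j) * MvPolynomial.X i)
        = (MvPolynomial.aeval fun j : Fin 2 =>
            ∑ i : Fin 2, MvPolynomial.C (g.1 i j) * MvPolynomial.X i).comp
          (MvPolynomial.aeval (R := ℂ) fun j : Fin 2 =>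
            ∑ i : Fin 2, MvPolynomial.C (k.1 i j) * MvPolynomial.X i) := by
      ext j : 1
      simp [Matrix.mul_apply, Fin.sum_univ_two, MvPolynomial.algebraMap_eq]
      ring
    rw [this]; rfl

/-- The exponent of the monomial `x₀ ^ (d - p) * x₁ ^ p`. -/
def expo (d : ℕ) (p : Fin (d + 1)) : Fin 2 →₀ ℕ :=
  Finsupp.single 0 (d - p) + Finsupp.single 1 (p : ℕ)

/-- The normalising factor `√((ℓ - m)! (ℓ + m)!)`, for `d = 2ℓ` and `p = ℓ + m`. -/
def normFactor (d : ℕ) (p : Fin (d + 1)) : ℝ :=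
  Real.sqrt (((d - p : ℕ).factorial : ℝ) * ((p : ℕ).factorial : ℝ))

/-- The standard basis vector of weight `m` of the spin `ℓ` representation, which acts on the
homogeneous polynomials of degree `2ℓ`: it is `x₀ ^ (ℓ - m) * x₁ ^ (ℓ + m)`, divided by
`√((ℓ - m)! (ℓ + m)!)`, where `d = 2ℓ` and `p = ℓ + m`. -/
def basisVec (d : ℕ) (p : Fin (d + 1)) : MvPolynomial (Fin 2) ℂ :=
  MvPolynomial.monomial (expo d p) ((normFactor d p : ℂ)⁻¹)

/-- An index `(ℓ, m, n)` of a matrix element: `ℓ ∈ ½ℕ` and `m, n ∈ {-ℓ, -ℓ + 1, …, ℓ}`, recorded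
through `2ℓ ∈ ℕ` and `ℓ + m, ℓ + n ∈ {0, …, 2ℓ}`. -/
@[ext]
structure SpinIndex where
  /-- the number `2ℓ` -/
  twoSpin : ℕ
  /-- the number `ℓ + m` -/
  row : Fin (twoSpin + 1)
  /-- the number `ℓ + n` -/
  col : Fin (twoSpin + 1)

namespace SpinIndex

/-- The spin `ℓ`. -/
def l (I : SpinIndex) : ℚ := I.twoSpin / 2

/-- The weight `m`. -/
def m (I : SpinIndex) : ℚ := (I.row : ℕ) - I.l

/-- The weight `n`. -/
def n (I : SpinIndex) : ℚ := (I.col : ℕ) - I.l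

end SpinIndex

/-- The matrix element `t^ℓ_{m,n}(g)`: the coefficient of the basis vector of weight `m` in the
image under `g` of the basis vector of weight `n` (see `polyRep_basisVec`). -/
def matrixElement (I : SpinIndex) (g : SU2) : ℂ :=
  normFactor I.twoSpin I.row *
    MvPolynomial.coeff (expo I.twoSpin I.row) (polyRep g (basisVec I.twoSpin I.col))

/-- The matrix elements are the entries of the spin `d / 2` representation in the standard basis. -/
theorem polyRep_basisVec (d : ℕ) (q : Fin (d + 1)) (g : SU2) :
    polyRep g (basisVec d q) = ∑ p : Fin (d + 1), matrixElement ⟨d, p, q⟩ g • basisVec d p := by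
  have hhom : (polyRep g (basisVec d q)).IsHomogeneous d := by
    have h0 : (basisVec d q).IsHomogeneous d := by
      apply MvPolynomial.isHomogeneous_monomial
      have := q.is_le
      simp [expo, Finsupp.degree_eq_sum, Fin.sum_univ_two]
      omega
    have := MvPolynomial.IsHomogeneous.aeval h0 (n := 1)
      (fun j : Fin 2 => ∑ i : Fin 2, MvPolynomial.C (g.1 i j) * MvPolynomial.X i) (by
        intro j
        refine MvPolynomial.IsHomogeneous.sum _ _ _ fun i _ => ?_
        simpa using (MvPolynomial.isHomogeneous_C (Fin 2) (g.1 i j)).mul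
          (MvPolynomial.isHomogeneous_X ℂ i))
    simpa [polyRep] using this
  have hne (p : Fin (d + 1)) : (normFactor d p : ℂ) ≠ 0 := by
    rw [normFactor, Ne, Complex.ofReal_eq_zero]
    positivity
  ext s
  simp only [MvPolynomial.coeff_sum, MvPolynomial.coeff_smul, basisVec, matrixElement,
    MvPolynomial.coeff_monomial, smul_eq_mul]
  by_cases hs : s 0 + s 1 = d
  · have hp : s = expo d ⟨s 1, by omega⟩ := by
      ext j; fin_cases j <;> simp [expo] <;> omega
    rw [Finset.sum_eq_single ⟨s 1, by omega⟩]
    · rw [if_pos hp.symm, ← hp]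
      field_simp [hne]
    · intro p _ hpne
      rw [if_neg, mul_zero]
      intro h
      apply hpne
      ext
      simp [← h, expo]
    · simp
  · rw [Finset.sum_eq_zero]
    · refine hhom.coeff_eq_zero ?_
      simpa [Finsupp.degree_eq_sum, Fin.sum_univ_two] using hs
    · intro p _
      rw [if_neg, mul_zero]
      intro h
      apply hs
      have := p.is_le
      simp [← h, expo]
      omega

end Mathieu

end

namespace Mathieu

/-! Expand `f ^ P` multinomially. Each monomial of exponent `k` in the matrix elements is a weight
vector for left and right translation by the torus, with weights `-2 ∑ k i * m i` and `-2 ∑ k i * n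
i`. Its integral vanishes unless both weights are zero, and an `SU(2)`-finite `h` pairs to zero with
weight vectors of large weight (`exists_weight_bound`). So everything depends on the position of the
origin relative to the points `(m i, n i)`.

If a linear functional is bounded below by some `c > 0` on these points, the weights of the
monomials in `f ^ P` grow linearly in `P`, and the conclusion holds
(`eventually_integral_eq_zero_of_separated`). In the other cases allowed by the rank condition, some
power of `f` has nonzero integral, contradicting the assumption on `f`.

In rank 3 the points form a nondegenerate triangle. If it does not contain the origin, a negative
barycentric coordinate of the origin gives the separating functional. If it does, clearing
denominators in the barycentric coordinates gives an exponent `k` such that `2 * k` is the only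
exponent of weight zero in its degree. The corresponding monomial is the square of a real function
that is not identically zero (`integral_pow_ne_zero_of_unique_relation`).

In rank 1 the three points coincide. A nonzero common point separates itself from the origin. If the
common point is zero, `f` is a nonzero polynomial `q` in `g₀₀ g₁₁`, which is uniformly distributed
on `[0, 1]`. An arithmetic argument with a large prime shows that some power of `q` has nonzero
integral over `[0, 1]` (`exists_unitIntegral_pow_ne_zero`). -/

open Polynomial in
/-- The linear functional `X ^ j ↦ 1 / (j + 1)`, that is, formal integration over `[0, 1]`. -/
noncomputable def unitIntegral {K : Type*} [Field K] (q : K[X]) : K :=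
  q.sum fun j c => c / ((j : K) + 1)

/-! ### Moments of a nonzero polynomial over the unit interval -/

section UnitIntegral

universe u

open Polynomial

variable {K : Type*} [Field K]

theorem unitIntegral_eq_sum_range (q : K[X]) {n : ℕ} (hn : q.natDegree < n) :
    unitIntegral q = ∑ j ∈ Finset.range n, q.coeff j / ((j : K) + 1) :=
  q.sum_over_range' (f := fun j c => c / ((j : K) + 1)) (fun _ => zero_div _) n hn

theorem unitIntegral_C_mul (a : K) (q : K[X]) : unitIntegral (C a * q) = a * unitIntegral q := by
  rw [unitIntegral_eq_sum_range (C a * q)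
      (Nat.lt_succ_of_le (natDegree_C_mul_le a q)),
    unitIntegral_eq_sum_range q (Nat.lt_succ_self _), Finset.mul_sum]
  exact Finset.sum_congr rfl fun j _ => by rw [coeff_C_mul, mul_div_assoc]

/-- A nonzero polynomial with integral coefficients has a power of nonzero integral: the `m`-th
power, where `p = m * deg q + 1` is a large prime, has a `p` in its denominator. -/
theorem exists_unitIntegral_pow_ne_zero_of_isIntegral [CharZero K] [Algebra.IsAlgebraic ℚ K]
    {q : K[X]} (hint : ∀ j, IsIntegral ℤ (q.coeff j)) (hq : 0 < q.natDegree) :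
    ∃ P : ℕ, 0 < P ∧ unitIntegral (q ^ P) ≠ 0 := by
  have ha : q.leadingCoeff ≠ 0 := leadingCoeff_ne_zero.mpr fun h => by simp [h] at hq
  have haint : IsIntegral ℤ q.leadingCoeff := hint _
  obtain ⟨N, hN, b, hb, hab⟩ : ∃ N : ℤ, N ≠ 0 ∧ ∃ b : K, IsIntegral ℤ b ∧
      b * q.leadingCoeff = N := by
    have hinv : IsAlgebraic ℤ (q.leadingCoeff⁻¹) :=
      (IsFractionRing.isAlgebraic_iff ℤ ℚ K).mpr (Algebra.IsAlgebraic.isAlgebraic _)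
    obtain ⟨y, hy, hy'⟩ := hinv.exists_integral_multiple
    refine ⟨y, hy, y • q.leadingCoeff⁻¹, hy', ?_⟩
    rw [zsmul_eq_mul, mul_assoc, inv_mul_cancel₀ ha, mul_one]
  -- With `p = m * deg q + 1`, the top term of `q ^ m` has denominator exactly `p`, while all other
  -- denominators divide `(p - 1)!`. The bound `p > |N|` keeps `p` from dividing a power of the
  -- leading coefficient.
  obtain ⟨p, hp, hpN, hpd⟩ := Nat.exists_prime_gt_modEq_one (k := q.natDegree) N.natAbs hq.ne'
  obtain ⟨m, hm⟩ : q.natDegree ∣ p - 1 := (Nat.modEq_iff_dvd' hp.one_le).mp hpd.symm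
  have hm0 : 0 < m := by
    rcases Nat.eq_zero_or_pos m with h | h
    · have := hp.two_le; subst h; omega
    · exact h
  refine ⟨m, hm0, fun h0 => ?_⟩
  have hdeg : (q ^ m).natDegree = p - 1 := by rw [natDegree_pow, hm, mul_comm]
  have hcint (j : ℕ) : IsIntegral ℤ ((q ^ m).coeff j) := by
    have hlift : q ∈ lifts (algebraMap (integralClosure ℤ K) K) :=
      (lifts_iff_coeff_lifts q).mpr fun j => ⟨⟨_, hint j⟩, rfl⟩
    obtain ⟨x, hx⟩ := (lifts_iff_coeff_lifts _).mp (pow_mem hlift m) j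
    rw [← hx]
    exact x.2
  have hlead : (q ^ m).coeff (p - 1) = q.leadingCoeff ^ m := by
    rw [← hdeg, coeff_natDegree, leadingCoeff_pow]
  have hp1 : p - 1 + 1 = p := Nat.sub_add_cancel hp.one_le
  have hpK : (p : K) ≠ 0 := Nat.cast_ne_zero.mpr hp.ne_zero
  rw [unitIntegral_eq_sum_range (q ^ m) (n := p - 1 + 1) (by omega), Finset.sum_range_succ,
    hlead] at h0
  set S : K := ∑ j ∈ Finset.range (p - 1), (q ^ m).coeff j / ((j : K) + 1) with hS
  have hSint : IsIntegral ℤ (((p - 1).factorial : K) * S) := by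
    rw [hS, Finset.mul_sum]
    refine IsIntegral.sum _ fun j hj => ?_
    obtain ⟨c, hc⟩ := Nat.dvd_factorial (Nat.succ_pos j)
      (Nat.succ_le_of_lt (Finset.mem_range.mp hj))
    have hj0 : (j : K) + 1 ≠ 0 := Nat.cast_add_one_ne_zero j
    have : ((p - 1).factorial : K) * ((q ^ m).coeff j / ((j : K) + 1)) =
        ((c : ℕ) : K) * (q ^ m).coeff j := by
      rw [hc]; push_cast; field_simp
    rw [this]
    have hc' : IsIntegral ℤ (c : K) := by
      simpa using isIntegral_algebraMap (R := ℤ) (A := K) (x := (c : ℤ))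
    exact hc'.mul (hcint j)
  have hcast : ((p - 1 : ℕ) : K) + 1 = p := by exact_mod_cast congrArg (Nat.cast (R := K)) hp1
  have hkey : ((N ^ m * (p - 1).factorial : ℤ) : K) =
      (p : K) * (-(b ^ m * (((p - 1).factorial : K) * S))) := by
    rw [hcast] at h0
    have : q.leadingCoeff ^ m = -(p * S) := by
      field_simp at h0
      linear_combination h0
    push_cast
    rw [← hab, mul_pow, this]
    ring
  -- A rational number that is integral over `ℤ` is an integer, so `p` must divide `N ^ m * (p -
  -- 1)!`.
  have hrat : IsIntegral ℤ (((N ^ m * (p - 1).factorial : ℤ) : ℚ) / p) := by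
    rw [← isIntegral_algebraMap_iff (algebraMap ℚ K).injective]
    have : algebraMap ℚ K (((N ^ m * (p - 1).factorial : ℤ) : ℚ) / p) =
        -(b ^ m * (((p - 1).factorial : K) * S)) := by
      rw [map_div₀, map_intCast, map_natCast, hkey, mul_div_cancel_left₀ _ hpK]
    rw [this]
    exact ((hb.pow m).mul hSint).neg
  obtain ⟨z, hz⟩ := IsIntegrallyClosed.isIntegral_iff.mp hrat
  have hdvd : (p : ℤ) ∣ N ^ m * (p - 1).factorial := by
    refine ⟨z, ?_⟩
    have hpQ : (p : ℚ) ≠ 0 := Nat.cast_ne_zero.mpr hp.ne_zero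
    rw [eq_div_iff hpQ] at hz
    have : ((N ^ m * (p - 1).factorial : ℤ) : ℚ) = ((p * z : ℤ) : ℚ) := by
      rw [← hz]; push_cast; simp [mul_comm]
    exact_mod_cast this
  have hpp : Prime (p : ℤ) := Nat.prime_iff_prime_int.mp hp
  rcases hpp.dvd_or_dvd hdvd with h | h
  · have h1 := Int.natAbs_dvd_natAbs.mpr (hpp.dvd_of_dvd_pow h)
    have := Nat.le_of_dvd (Int.natAbs_pos.mpr hN) h1
    simp at this
    omega
  · have h1 : p ∣ (p - 1).factorial := by exact_mod_cast h
    have := (hp.dvd_factorial).mp h1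
    omega

/-- A common denominator makes the coefficients integral; scaling `q` by a nonzero constant only
scales the integrals of its powers. -/
theorem exists_unitIntegral_pow_ne_zero_of_isAlgebraic [CharZero K] [Algebra.IsAlgebraic ℚ K]
    {q : K[X]} (hq : q ≠ 0) : ∃ P : ℕ, 0 < P ∧ unitIntegral (q ^ P) ≠ 0 := by
  rcases Nat.eq_zero_or_pos q.natDegree with hd | hd
  · refine ⟨1, one_pos, ?_⟩
    rw [pow_one, unitIntegral_eq_sum_range q (n := 1) (by omega)]
    rw [eq_C_of_natDegree_eq_zero hd] at hq
    simpa using hq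
  classical
  have : Algebra.IsAlgebraic ℤ K := 
    (IsFractionRing.comap_isAlgebraic_iff (A := ℤ) (K := ℚ) (C := K)).mpr inferInstance
  obtain ⟨y, hy, hint⟩ := Algebra.IsAlgebraic.exists_integral_multiples (R := ℤ)
    (q.support.image q.coeff)
  have hyK : (y : K) ≠ 0 := by exact_mod_cast hy
  obtain ⟨P, hP, hne⟩ := exists_unitIntegral_pow_ne_zero_of_isIntegral (q := C (y : K) * q)
    (fun j => by
      rw [coeff_C_mul]
      by_cases hj : q.coeff j = 0
      · rw [hj, mul_zero]; exact isIntegral_zero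
      · have := hint (q.coeff j) (Finset.mem_image_of_mem _ (mem_support_iff.mpr hj))
        rwa [zsmul_eq_mul] at this)
    (by rwa [natDegree_C_mul hyK])
  refine ⟨P, hP, fun h => hne ?_⟩
  rw [mul_pow, ← C_pow, unitIntegral_C_mul, h, mul_zero]

/-- Nullstellensatz: a nonzero finitely generated `ℚ`-algebra has a point over a number field. -/
theorem exists_ringHom_isAlgebraic (B : Type u) [CommRing B] [Nontrivial B] [Algebra ℚ B]
    [hft : Algebra.FiniteType ℚ B] :
    ∃ (F : Type u) (_ : Field F) (_ : CharZero F),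
      Algebra.IsAlgebraic ℚ F ∧ Nonempty (B →+* F) := by
  obtain ⟨M, hM⟩ := Ideal.exists_maximal B
  let _ : Field (B ⧸ M) := Ideal.Quotient.field M
  have : Algebra.FiniteType ℚ (B ⧸ M) :=
    hft.of_surjective (Ideal.Quotient.mkₐ ℚ M) (Ideal.Quotient.mkₐ_surjective ℚ M)
  have hfin : Module.Finite ℚ (B ⧸ M) := finite_of_finite_type_of_isJacobsonRing ℚ (B ⧸ M)
  have halg : Algebra.IsAlgebraic ℚ (B ⧸ M) := inferInstance
  refine ⟨B ⧸ M, Ideal.Quotient.field M, algebraRat.charZero _, ?_, ⟨Ideal.Quotient.mk M⟩⟩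
  convert halg
  · rfl
  · exact Subsingleton.elim _ _

/-- A nonzero polynomial over a field of characteristic zero has a positive power with nonzero
integral over `[0, 1]`. -/
theorem exists_unitIntegral_pow_ne_zero [CharZero K] {q : K[X]} (hq : q ≠ 0) :
    ∃ P : ℕ, 0 < P ∧ unitIntegral (q ^ P) ≠ 0 := by
  classical
  by_contra! hzero
  -- Including the inverse of the leading coefficient makes that coefficient a unit of `B`, so no
  -- homomorphism to a field can kill `q`.
  set s : Finset K := insert (q.leadingCoeff⁻¹) (q.support.image q.coeff) with hs
  let B := Algebra.adjoin ℚ (s : Set K)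
  have hft : Algebra.FiniteType ℚ B := (Subalgebra.fg_iff_finiteType _).mp ⟨s, rfl⟩
  have hcoeff (j : ℕ) : q.coeff j ∈ B := by
    by_cases hj : q.coeff j = 0
    · rw [hj]; exact zero_mem _
    · exact Algebra.subset_adjoin (Finset.mem_insert_of_mem
        (Finset.mem_image_of_mem _ (mem_support_iff.mpr hj)))
  have hinv : q.leadingCoeff⁻¹ ∈ B := Algebra.subset_adjoin (Finset.mem_insert_self _ _)
  obtain ⟨F, _, _, _, ⟨π⟩⟩ := exists_ringHom_isAlgebraic B
  obtain ⟨r, hr⟩ : ∃ r : B[X], r.map (algebraMap B K) = q := by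
    have : q ∈ lifts (algebraMap B K) :=
      (lifts_iff_coeff_lifts q).mpr fun j => ⟨⟨_, hcoeff j⟩, rfl⟩
    exact (mem_lifts q).mp this
  have hrF : r.map π ≠ 0 := by
    intro h
    have h1 : π (r.coeff q.natDegree) = 0 := by
      have := congrArg (fun u => u.coeff q.natDegree) h
      simpa using this
    have h2 : r.coeff q.natDegree * ⟨_, hinv⟩ = 1 := by
      apply Subtype.ext
      have : ((r.coeff q.natDegree : B) : K) = q.leadingCoeff := by
        have := congrArg (fun u => u.coeff q.natDegree) hr
        simpa using this
      simp [this, hq]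
    have h3 := congrArg π h2
    rw [map_mul, h1, zero_mul, map_one] at h3
    exact zero_ne_one h3
  obtain ⟨P, hP, hne⟩ := exists_unitIntegral_pow_ne_zero_of_isAlgebraic hrF
  apply hne
  -- The integral of the power is already defined in the `ℚ`-algebra `B`; its images in `K` and in
  -- `F` are the two integrals being compared.
  let S : B := ∑ j ∈ Finset.range ((r ^ P).natDegree + 1), (((j : ℚ) + 1)⁻¹) • (r ^ P).coeff j
  have hSF : unitIntegral ((r.map π) ^ P) = π S := by
    rw [← Polynomial.map_pow, unitIntegral_eq_sum_range _ (Nat.lt_succ_of_le natDegree_map_le),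
      map_sum]
    refine Finset.sum_congr rfl fun j _ => ?_
    rw [Algebra.smul_def, map_mul, coeff_map, div_eq_inv_mul, ← RingHom.comp_apply, eq_ratCast]
    simp
  have hSK : unitIntegral (q ^ P) = algebraMap B K S := by
    rw [← hr, ← Polynomial.map_pow, unitIntegral_eq_sum_range _ (Nat.lt_succ_of_le natDegree_map_le),
      map_sum]
    refine Finset.sum_congr rfl fun j _ => ?_
    rw [Algebra.smul_def, map_mul, coeff_map, div_eq_inv_mul, ← RingHom.comp_apply, eq_ratCast]
    simp
  rw [hzero P hP] at hSK
  have hS0 : S = 0 := by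
    apply Subtype.ext
    exact hSK.symm
  rw [hSF, hS0, map_zero]

end UnitIntegral

/-! ### Invariance of Haar measure and the weights seen by a finite function -/

/-- The right translates of a `G`-finite function span a finite-dimensional space. -/
theorem IsGFinite.exists_right {G : Type*} [Group G] [TopologicalSpace G] {h : G → ℂ} (hh : IsGFinite h) :
    ∃ W : Submodule ℂ (G → ℂ), FiniteDimensional ℂ W ∧ ∀ b, (fun g => h (g * b)) ∈ W := by
  let V := Submodule.span ℂ (Set.range fun (a : G) (g : G) => h (a * g))
  have : FiniteDimensional ℂ V := hh.2
  let T : Module.Dual ℂ V →ₗ[ℂ] (G → ℂ) :=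
    { toFun := fun φ a => φ ⟨fun g => h (a * g), Submodule.subset_span ⟨a, rfl⟩⟩
      map_add' := fun _ _ => rfl
      map_smul' := fun _ _ => rfl }
  -- The right translate by `b` is the image under `T` of evaluation at `b` on the span `V` of the
  -- left translates.
  exact ⟨LinearMap.range T, inferInstance, fun b => ⟨(LinearMap.proj b).comp V.subtype, rfl⟩⟩

section Haar

variable {G : Type*} [Group G] [TopologicalSpace G] [IsTopologicalGroup G] [CompactSpace G]
  [MeasurableSpace G] [BorelSpace G]

instance : Measure.IsHaarMeasure (normalizedHaar G) := by
  unfold normalizedHaar; infer_instance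

instance : IsProbabilityMeasure (normalizedHaar G) :=
  ⟨Measure.haarMeasure_self (K₀ := (⊤ : TopologicalSpace.PositiveCompacts G))⟩

/-- A right translate of the Haar measure is again a left-invariant probability measure, so
uniqueness applies. -/
instance : Measure.IsMulRightInvariant (normalizedHaar G) where
  map_mul_right_eq_self g := by
    have : IsProbabilityMeasure (Measure.map (· * g) (normalizedHaar G)) :=
      Measure.isProbabilityMeasure_map (measurable_mul_const g).aemeasurable
    have : Measure.IsHaarMeasure (Measure.map (· * g) (normalizedHaar G)) :=
      inferInstance
    exact Measure.isHaarMeasure_eq_of_isProbabilityMeasure _ _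

theorem integrable_normalizedHaar {F : G → ℂ} (hF : Continuous F) :
    Integrable F (normalizedHaar G) :=
  hF.integrable_of_hasCompactSupport (HasCompactSupport.of_compactSpace F)

theorem integral_eq_zero_of_mul_left {F : G → ℂ} {a : G} {c : ℂ} (hc : c ≠ 1)
    (hF : ∀ g, F (a * g) = c * F g) : ∫ g, F g ∂(normalizedHaar G) = 0 := by
  have h := integral_mul_left_eq_self (μ := normalizedHaar G) F a
  simp_rw [hF, integral_const_mul] at h
  exact (mul_left_eq_self₀.mp h).resolve_left hc

theorem integral_eq_zero_of_mul_right {F : G → ℂ} {a : G} {c : ℂ} (hc : c ≠ 1)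
    (hF : ∀ g, F (g * a) = c * F g) : ∫ g, F g ∂(normalizedHaar G) = 0 := by
  have h := integral_mul_right_eq_self (μ := normalizedHaar G) F a
  simp_rw [hF, integral_const_mul] at h
  exact (mul_left_eq_self₀.mp h).resolve_left hc

/-- Vectors in a finite-dimensional space, indexed by `ℕ`, satisfy a nontrivial linear relation. -/
theorem exists_polynomial_relation {V : Type*} [AddCommGroup V] [Module ℂ V] (W : Submodule ℂ V)
    [FiniteDimensional ℂ W] {u : ℕ → V} (hu : ∀ k, u k ∈ W) :
    ∃ q : Polynomial ℂ, q ≠ 0 ∧ (q.sum fun k c => c • u k) = 0 := by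
  let Φ : Polynomial ℂ →ₗ[ℂ] W :=
    Polynomial.lsum fun k => LinearMap.toSpanSingleton ℂ W ⟨u k, hu k⟩
  have hΦ : ¬ Function.Injective Φ := fun h =>
    Polynomial.not_finite (R := ℂ) (Module.Finite.of_injective Φ h)
  rw [← LinearMap.ker_eq_bot, Submodule.eq_bot_iff] at hΦ
  push Not at hΦ
  obtain ⟨q, hq, hq0⟩ := hΦ
  refine ⟨q, hq0, ?_⟩
  have h := congrArg W.subtype (LinearMap.mem_ker.mp hq)
  simpa [Φ, Polynomial.lsum_apply, Polynomial.sum] using h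

/-- If the iterates of `h` under a measure preserving map `σ` span a finite-dimensional space,
then `h` is orthogonal to all `F` which transform under `σ` by a character of large weight. -/
theorem exists_weight_bound {σ : G → G} (hσc : Continuous σ)
    (hσ : ∀ E : G → ℂ, ∫ g, E (σ g) ∂(normalizedHaar G) = ∫ g, E g ∂(normalizedHaar G))
    {h : G → ℂ} (hh : Continuous h) (W : Submodule ℂ (G → ℂ)) [FiniteDimensional ℂ W]
    (hW : ∀ k, (fun g => h (σ^[k] g)) ∈ W) {ζ : ℂ} (hζ0 : ζ ≠ 0)
    (hζ : Function.Injective fun w : ℤ => ζ ^ w) :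
    ∃ N : ℕ, ∀ F : G → ℂ, Continuous F → ∀ w : ℤ, (∀ g, F (σ g) = ζ ^ w * F g) →
      N < w.natAbs → ∫ g, F g * h g ∂(normalizedHaar G) = 0 := by
  -- Replacing `h` by its `k`-th iterate multiplies the pairing with `F` by `ζ ^ (-w * k)`. The
  -- relation `q` therefore gives `q(ζ ^ (-w)) * ∫ F h = 0`, and only finitely many `w` make the
  -- first factor vanish.
  obtain ⟨q, hq, hrel⟩ := exists_polynomial_relation W hW
  have hfin : {w : ℤ | q.eval ((ζ ^ w)⁻¹) = 0}.Finite := by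
    refine Set.Finite.of_finite_image (f := fun w : ℤ => (ζ ^ w)⁻¹)
      ((q.roots.toFinset.finite_toSet).subset ?_)
      ((inv_injective.comp hζ).injOn)
    rintro _ ⟨w, hw, rfl⟩
    simpa [hq] using hw
  obtain ⟨N, hN⟩ := (hfin.image Int.natAbs).bddAbove
  refine ⟨N, fun F hF w hFw hw => ?_⟩
  have hint (k : ℕ) : Integrable (fun g => F g * h (σ^[k] g)) (normalizedHaar G) :=
    integrable_normalizedHaar (hF.mul (hh.comp (hσc.iterate k)))
  have hstep (k : ℕ) : ∫ g, F g * h (σ^[k] g) ∂(normalizedHaar G) =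
      ((ζ ^ w)⁻¹) ^ k * ∫ g, F g * h g ∂(normalizedHaar G) := by
    induction k with
    | zero => simp
    | succ k ih =>
      rw [pow_succ', mul_assoc, ← ih, ← hσ fun g => F g * h (σ^[k] g), ← integral_const_mul]
      refine integral_congr_ae (.of_forall fun g => ?_)
      have := zpow_ne_zero w hζ0
      simp only [hFw, Function.iterate_succ_apply]
      field_simp
  have hsum : q.eval ((ζ ^ w)⁻¹) * ∫ g, F g * h g ∂(normalizedHaar G) = 0 := by
    rw [Polynomial.eval_eq_sum, Polynomial.sum, Finset.sum_mul]
    have : ∀ k ∈ q.support, q.coeff k * (ζ ^ w)⁻¹ ^ k * ∫ g, F g * h g ∂(normalizedHaar G) =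
        ∫ g, q.coeff k * (F g * h (σ^[k] g)) ∂(normalizedHaar G) := fun k _ => by
      rw [integral_const_mul, hstep, mul_assoc]
    rw [Finset.sum_congr rfl this, ← integral_finsetSum _ fun k _ => (hint k).const_mul _]
    refine (integral_congr_ae (.of_forall fun g => ?_)).trans (integral_zero G ℂ)
    have h1 := congrFun hrel g
    simp only [Polynomial.sum, Finset.sum_apply, Pi.smul_apply, smul_eq_mul, Pi.zero_apply] at h1
    have : ∀ k ∈ q.support, q.coeff k * (F g * h (σ^[k] g)) =
        F g * (q.coeff k * h (σ^[k] g)) := fun k _ => by ring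
    rw [Finset.sum_congr rfl this, ← Finset.mul_sum, h1, mul_zero]
  refine (mul_eq_zero.mp hsum).resolve_left fun h0 => ?_
  exact absurd (hN ⟨w, h0, rfl⟩) (not_le.mpr hw)

theorem IsGFinite.exists_left_weight_bound {h : G → ℂ} (hh : IsGFinite h) (a : G) {ζ : ℂ}
    (hζ0 : ζ ≠ 0) (hζ : Function.Injective fun w : ℤ => ζ ^ w) :
    ∃ N : ℕ, ∀ F : G → ℂ, Continuous F → ∀ w : ℤ, (∀ g, F (a * g) = ζ ^ w * F g) →
      N < w.natAbs → ∫ g, F g * h g ∂(normalizedHaar G) = 0 := by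
  have := hh.2
  refine exists_weight_bound (continuous_const_mul a)
    (fun E => integral_mul_left_eq_self E a) hh.1
    (Submodule.span ℂ (Set.range fun (a : G) (g : G) => h (a * g))) (fun k => ?_) hζ0 hζ
  refine Submodule.subset_span ⟨a ^ k, ?_⟩
  simp [mul_left_iterate]

theorem IsGFinite.exists_right_weight_bound {h : G → ℂ} (hh : IsGFinite h) (a : G) {ζ : ℂ}
    (hζ0 : ζ ≠ 0) (hζ : Function.Injective fun w : ℤ => ζ ^ w) :
    ∃ N : ℕ, ∀ F : G → ℂ, Continuous F → ∀ w : ℤ, (∀ g, F (g * a) = ζ ^ w * F g) →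
      N < w.natAbs → ∫ g, F g * h g ∂(normalizedHaar G) = 0 := by
  obtain ⟨W, hW, hmem⟩ := hh.exists_right
  refine exists_weight_bound (continuous_mul_const a)
    (fun E => integral_mul_right_eq_self E a) hh.1 W (fun k => ?_) hζ0 hζ
  simpa [mul_right_iterate] using hmem (a ^ k)

/-- A nonnegative continuous function which does not vanish has nonzero integral. -/
theorem integral_sq_ne_zero {T : G → ℂ} (hT : Continuous T) (hreal : ∀ g, (T g).im = 0) {g₀ : G}
    (hg₀ : T g₀ ≠ 0) : ∫ g, T g ^ 2 ∂(normalizedHaar G) ≠ 0 := by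
  have hre (g : G) : T g = ((T g).re : ℂ) := Complex.ext rfl (by simp [hreal])
  have h1 : ∫ g, T g ^ 2 ∂(normalizedHaar G) =
      ((∫ g, (T g).re ^ 2 ∂(normalizedHaar G) : ℝ) : ℂ) := by
    rw [← integral_complex_ofReal]
    refine integral_congr_ae (.of_forall fun g => ?_)
    simp only
    rw [hre g]
    simp
  rw [h1, Complex.ofReal_ne_zero]
  refine (Continuous.integral_pos_of_hasCompactSupport_nonneg_nonzero (x := g₀)
    ((Complex.continuous_re.comp hT).pow 2) (HasCompactSupport.of_compactSpace _)
    (fun g => sq_nonneg _) ?_).ne'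
  intro h0
  apply hg₀
  rw [hre g₀, Complex.ofReal_eq_zero]
  exact pow_eq_zero_iff two_ne_zero |>.mp h0

end Haar

/-! ### Coordinates, torus and rotations in `SU(2)` -/

section Group

open ComplexConjugate

theorem continuous_entry (i j : Fin 2) : Continuous fun g : SU2 => g.1 i j :=
  (continuous_apply j).comp ((continuous_apply i).comp continuous_subtype_val)

/-- The conjugate transpose and the adjugate are both inverse to `g`, hence equal. -/
theorem entry_relations (g : SU2) :
    g.1 1 0 = -conj (g.1 0 1) ∧ g.1 1 1 = conj (g.1 0 0) ∧
      g.1 0 1 * g.1 1 0 = g.1 0 0 * g.1 1 1 - 1 := by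
  obtain ⟨hu, hdet⟩ := Matrix.mem_specialUnitaryGroup_iff.mp g.2
  have h1 : star g.1 = Matrix.adjugate g.1 := by
    have h2 : g.1 * star g.1 = 1 := Matrix.mem_unitaryGroup_iff.mp hu
    have h3 : Matrix.adjugate g.1 * g.1 = 1 := by rw [Matrix.adjugate_mul, hdet, one_smul]
    exact (left_inv_eq_right_inv h3 h2).symm
  rw [Matrix.adjugate_fin_two] at h1
  rw [Matrix.det_fin_two] at hdet
  have h00 := congrFun (congrFun h1 0) 0
  have h10 := congrFun (congrFun h1 1) 0
  simp [Matrix.star_apply] at h00 h10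
  refine ⟨?_, h00.symm, by linear_combination -hdet⟩
  rw [h10]; ring

/-- The element of `SU(2)` with first row `(a, b)`. -/
noncomputable def ofRow (a b : ℂ) (h : a * conj a + b * conj b = 1) : SU2 :=
  ⟨!![a, b; -conj b, conj a], by
    rw [Matrix.mem_specialUnitaryGroup_iff, Matrix.mem_unitaryGroup_iff]
    constructor
    · ext i j
      fin_cases i <;> fin_cases j <;>
        simp [Matrix.mul_apply, Fin.sum_univ_two, Matrix.star_apply]
      · linear_combination h
      · ring
      · ring
      · linear_combination h
    · rw [Matrix.det_fin_two_of]
      linear_combination h⟩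

/-- The element `diag(z, z⁻¹)` of the maximal torus. -/
noncomputable def torus (z : Circle) : SU2 := ofRow z 0 (by simp [Complex.mul_conj])

theorem torus_mul_apply_zero (z : Circle) (g : SU2) (j : Fin 2) :
    (torus z * g).1 0 j = z * g.1 0 j := by
  simp [torus, ofRow, Matrix.mul_apply, Fin.sum_univ_two]

theorem torus_mul_apply_one (z : Circle) (g : SU2) (j : Fin 2) :
    (torus z * g).1 1 j = (z : ℂ)⁻¹ * g.1 1 j := by
  simp [torus, ofRow, Matrix.mul_apply, Fin.sum_univ_two, ← Circle.coe_inv_eq_conj]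

theorem mul_torus_apply_zero (z : Circle) (g : SU2) (i : Fin 2) :
    (g * torus z).1 i 0 = z * g.1 i 0 := by
  simp [torus, ofRow, Matrix.mul_apply, Fin.sum_univ_two, mul_comm]

theorem mul_torus_apply_one (z : Circle) (g : SU2) (i : Fin 2) :
    (g * torus z).1 i 1 = (z : ℂ)⁻¹ * g.1 i 1 := by
  simp [torus, ofRow, Matrix.mul_apply, Fin.sum_univ_two, ← Circle.coe_inv_eq_conj, mul_comm]

/-- A unit complex number that is not a root of unity. -/
noncomputable def generator : Circle := Circle.exp 1

/-- A coincidence of two powers would express `π` as a rational number. -/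
theorem generator_zpow_injective : Function.Injective fun w : ℤ => ((generator : Circle) : ℂ) ^ w := by
  have key (n : ℤ) (h : (generator : ℂ) ^ n = 1) : n = 0 := by
    rw [generator, Circle.coe_exp, ← Complex.exp_int_mul, Complex.exp_eq_one_iff] at h
    obtain ⟨k, hk⟩ := h
    have hre : (n : ℝ) = k * (2 * Real.pi) := by
      have := congrArg Complex.im hk
      simpa using this
    by_contra hn
    have hk0 : k ≠ 0 := by
      rintro rfl
      simp at hre
      exact hn hre
    apply irrational_pi
    refine ⟨n / (2 * k), ?_⟩
    have : (k : ℝ) ≠ 0 := Int.cast_ne_zero.mpr hk0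
    push_cast
    rw [hre]
    field_simp
  intro a b hab
  have h0 : (generator : ℂ) ≠ 0 := Circle.coe_ne_zero _
  have : (generator : ℂ) ^ (a - b) = 1 := by
    rw [zpow_sub₀ h0]
    simp only at hab
    rw [hab, div_self (zpow_ne_zero _ h0)]
  have := key _ this
  omega

theorem generator_zpow_ne_one {w : ℤ} (hw : w ≠ 0) : (generator : ℂ) ^ w ≠ 1 := fun h =>
  hw (generator_zpow_injective (by simpa using h))

/-- The scalar `(1 + τ²)^(-1/2)`. -/
noncomputable def rotationScale (τ : ℝ) : ℝ := (Real.sqrt (1 + τ ^ 2))⁻¹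

theorem rotationScale_sq (τ : ℝ) : (rotationScale τ : ℂ) ^ 2 * (1 + (τ : ℂ) ^ 2) = 1 := by
  have h : (0 : ℝ) < 1 + τ ^ 2 := by positivity
  have : rotationScale τ ^ 2 * (1 + τ ^ 2) = 1 := by
    rw [rotationScale, inv_pow, Real.sq_sqrt h.le, inv_mul_cancel₀ h.ne']
  exact_mod_cast this

theorem rotationScale_ne_zero (τ : ℝ) : (rotationScale τ : ℂ) ≠ 0 := fun h => by
  have := rotationScale_sq τ
  simp [h] at this

/-- The rotation in `SU(2)` with tangent `τ`. -/
noncomputable def rotation (τ : ℝ) : SU2 := ofRow (rotationScale τ) (rotationScale τ * τ) (by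
  simp only [map_mul, Complex.conj_ofReal]
  linear_combination rotationScale_sq τ)

theorem rotation_val (τ : ℝ) : (rotation τ).1 =
    !![(rotationScale τ : ℂ), rotationScale τ * τ; -(rotationScale τ * τ), rotationScale τ] := by
  simp [rotation, ofRow]

/-- Every torus double coset contains a real matrix. -/
theorem exists_torus_mul_real (g : SU2) :
    ∃ z w : Circle, ∀ i j, ∃ x : ℝ, (torus z * g * torus w).1 i j = x := by
  set A := (g.1 0 0).arg
  set B := (g.1 0 1).arg
  obtain ⟨z, w, h00, h01⟩ : ∃ z w : Circle, (z : ℂ) * w * g.1 0 0 = ‖g.1 0 0‖ ∧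
      (z : ℂ) * (w : ℂ)⁻¹ * g.1 0 1 = ‖g.1 0 1‖ := by
    -- The angles of `z` and `w` have sum `-A` and difference `-B`, which cancels the arguments of
    -- both entries of the first row; the second row is determined by the first.
    refine ⟨Circle.exp (-(A + B) / 2), Circle.exp ((B - A) / 2), ?_, ?_⟩
    · conv_lhs => rw [← Complex.norm_mul_exp_arg_mul_I (g.1 0 0)]
      rw [Circle.coe_exp, Circle.coe_exp, ← Complex.exp_add, mul_left_comm, ← Complex.exp_add]
      convert mul_one _
      rw [Complex.exp_eq_one_iff]
      refine ⟨0, ?_⟩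
      push_cast
      ring
    · conv_lhs => rw [← Complex.norm_mul_exp_arg_mul_I (g.1 0 1)]
      rw [Circle.coe_exp, Circle.coe_exp, ← Complex.exp_neg, ← Complex.exp_add, mul_left_comm,
        ← Complex.exp_add]
      convert mul_one _
      rw [Complex.exp_eq_one_iff]
      refine ⟨0, ?_⟩
      push_cast
      ring
  set k := torus z * g * torus w with hk
  have hk00 : k.1 0 0 = (‖g.1 0 0‖ : ℝ) := by
    rw [hk, mul_torus_apply_zero, torus_mul_apply_zero, ← h00]; ring
  have hk01 : k.1 0 1 = (‖g.1 0 1‖ : ℝ) := by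
    rw [hk, mul_torus_apply_one, torus_mul_apply_zero, ← h01]; ring
  obtain ⟨h10, h11, -⟩ := entry_relations k
  refine ⟨z, w, ?_⟩
  rw [← hk]
  intro i j
  fin_cases i <;> fin_cases j
  · exact ⟨_, hk00⟩
  · exact ⟨_, hk01⟩
  · exact ⟨-‖g.1 0 1‖, by simp [h10, hk01]⟩
  · exact ⟨‖g.1 0 0‖, by simp [h11, hk00]⟩

end Group

/-! ### The distribution of `g₀₀ g₁₁` -/

section Integral

/-- The integral of a monomial in the matrix entries of right torus weight different from zero. -/
theorem integral_entries_eq_zero {n i j : ℕ} (hi : i ≤ n) (hj : j ≤ n) (hij : i ≠ j) :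
    ∫ g : SU2, g.1 0 1 ^ i * g.1 0 0 ^ (n - i) * (g.1 1 0 ^ j * g.1 1 1 ^ (n - j))
      ∂(normalizedHaar SU2) = 0 := by
  have hw : (2 * (j : ℤ) - 2 * i) ≠ 0 := by omega
  refine integral_eq_zero_of_mul_right (a := torus generator) (generator_zpow_ne_one hw)
    fun g => ?_
  simp only [mul_torus_apply_zero, mul_torus_apply_one]
  have h0 : (generator : ℂ) ≠ 0 := Circle.coe_ne_zero _
  obtain ⟨a, ha⟩ : ∃ a, a = n - i := ⟨_, rfl⟩
  obtain ⟨b, hb⟩ : ∃ b, b = n - j := ⟨_, rfl⟩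
  have hz : (generator : ℂ) ^ (2 * (j : ℤ) - 2 * i) =
      ((generator : ℂ)⁻¹) ^ i * (generator : ℂ) ^ a *
        ((generator : ℂ) ^ j * ((generator : ℂ)⁻¹) ^ b) := by
    rw [inv_pow, inv_pow, ← zpow_natCast _ i, ← zpow_natCast _ a, ← zpow_natCast _ j,
      ← zpow_natCast _ b, ← zpow_neg, ← zpow_neg, ← zpow_add₀ h0, ← zpow_add₀ h0, ← zpow_add₀ h0]
    congr 1
    omega
  rw [hz, ← ha, ← hb]
  simp only [mul_pow]
  ring

/-- Comparing the integrals of `(g₀₀ g₁₁) ^ n` and of its right translate by a rotation. -/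
theorem integral_rotation_identity (n : ℕ) (τ : ℝ) :
    ∑ i ∈ Finset.range (n + 1), (n.choose i : ℂ) ^ 2 * (-1) ^ i *
      (∫ g : SU2, (g.1 0 1 * g.1 1 0) ^ i * (g.1 0 0 * g.1 1 1) ^ (n - i) ∂(normalizedHaar SU2)) *
        ((τ : ℂ) ^ 2) ^ i =
    (∫ g : SU2, (g.1 0 0 * g.1 1 1) ^ n ∂(normalizedHaar SU2)) * (1 + (τ : ℂ) ^ 2) ^ n := by
  have hs := rotationScale_sq τ
  have htrans := integral_mul_right_eq_self (μ := normalizedHaar SU2)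
    (fun g : SU2 => (g.1 0 0 * g.1 1 1) ^ n) (rotation τ)
  have hval (g : SU2) : (g * rotation τ).1 0 0 * (g * rotation τ).1 1 1 =
      (rotationScale τ : ℂ) ^ 2 *
        ((-τ * g.1 0 1 + g.1 0 0) * (τ * g.1 1 0 + g.1 1 1)) := by
    have : (g * rotation τ).1 = g.1 * (rotation τ).1 := rfl
    rw [this, rotation_val]
    simp [Matrix.mul_apply, Fin.sum_univ_two]
    ring
  simp only [hval] at htrans
  simp only [mul_pow _ _ n, integral_const_mul] at htrans
  have hmul : (∫ g : SU2, (-τ * g.1 0 1 + g.1 0 0) ^ n * (τ * g.1 1 0 + g.1 1 1) ^ n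
      ∂(normalizedHaar SU2)) =
      (∫ g : SU2, (g.1 0 0 * g.1 1 1) ^ n ∂(normalizedHaar SU2)) * (1 + (τ : ℂ) ^ 2) ^ n := by
    simp only [mul_pow _ _ n]
    rw [← htrans]
    have h1 : ((rotationScale τ : ℂ) ^ 2) ^ n * (1 + (τ : ℂ) ^ 2) ^ n = 1 := by
      rw [← mul_pow, hs, one_pow]
    linear_combination (-(∫ g : SU2, (-τ * g.1 0 1 + g.1 0 0) ^ n * (τ * g.1 1 0 + g.1 1 1) ^ n
      ∂(normalizedHaar SU2))) * h1
  rw [← hmul]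
  have hexp (g : SU2) : (-τ * g.1 0 1 + g.1 0 0) ^ n * (τ * g.1 1 0 + g.1 1 1) ^ n =
      ∑ i ∈ Finset.range (n + 1), ∑ j ∈ Finset.range (n + 1),
        ((-τ) ^ i * n.choose i * (τ ^ j * n.choose j) : ℂ) *
        (g.1 0 1 ^ i * g.1 0 0 ^ (n - i) * (g.1 1 0 ^ j * g.1 1 1 ^ (n - j))) := by
    rw [add_pow, add_pow, Finset.sum_mul_sum]
    refine Finset.sum_congr rfl fun i _ => Finset.sum_congr rfl fun j _ => ?_
    rw [mul_pow, mul_pow]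
    ring
  have e := continuous_entry
  have hint (i j : ℕ) : Integrable (fun g : SU2 =>
      ((-τ) ^ i * n.choose i * (τ ^ j * n.choose j) : ℂ) *
        (g.1 0 1 ^ i * g.1 0 0 ^ (n - i) * (g.1 1 0 ^ j * g.1 1 1 ^ (n - j))))
      (normalizedHaar SU2) :=
    integrable_normalizedHaar (continuous_const.mul
      ((((e 0 1).pow i).mul ((e 0 0).pow _)).mul (((e 1 0).pow j).mul ((e 1 1).pow _))))
  simp only [hexp]
  rw [integral_finsetSum _ fun i _ => integrable_finsetSum _ fun j _ => hint i j]
  refine Finset.sum_congr rfl fun i hi => ?_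
  -- Only the diagonal term `j = i` has right torus weight zero.
  rw [integral_finsetSum _ fun j _ => hint i j, Finset.sum_eq_single i]
  · rw [integral_const_mul]
    have : (fun g : SU2 => g.1 0 1 ^ i * g.1 0 0 ^ (n - i) * (g.1 1 0 ^ i * g.1 1 1 ^ (n - i))) =
        fun g : SU2 => (g.1 0 1 * g.1 1 0) ^ i * (g.1 0 0 * g.1 1 1) ^ (n - i) := by
      funext g
      rw [mul_pow, mul_pow]; ring
    rw [this, neg_pow (τ : ℂ) i]
    ring
  · intro j hj hji
    rw [integral_const_mul, integral_entries_eq_zero (Nat.lt_succ_iff.mp (Finset.mem_range.mp hi))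
      (Nat.lt_succ_iff.mp (Finset.mem_range.mp hj)) hji.symm, mul_zero]
  · exact fun h => absurd hi h

/-- Compare the coefficients of `τ²` in `integral_rotation_identity` for the exponent `k + 1`. The
one on the left involves `g₀₁ g₁₀ = g₀₀ g₁₁ - 1`, which brings in the integral of the `k`-th power.
-/
theorem integral_pow_succ (k : ℕ) :
    (k + 2 : ℂ) * ∫ g : SU2, (g.1 0 0 * g.1 1 1) ^ (k + 1) ∂(normalizedHaar SU2) =
      (k + 1) * ∫ g : SU2, (g.1 0 0 * g.1 1 1) ^ k ∂(normalizedHaar SU2) := by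
  let J (i : ℕ) : ℂ := ∫ g : SU2, (g.1 0 1 * g.1 1 0) ^ i * (g.1 0 0 * g.1 1 1) ^ (k + 1 - i)
    ∂(normalizedHaar SU2)
  set I₁ := ∫ g : SU2, (g.1 0 0 * g.1 1 1) ^ (k + 1) ∂(normalizedHaar SU2) with hI₁
  have hpoly : ∑ i ∈ Finset.range (k + 1 + 1),
      Polynomial.C (((k + 1).choose i : ℂ) ^ 2 * (-1) ^ i * J i) * Polynomial.X ^ i =
      Polynomial.C I₁ * (1 + Polynomial.X) ^ (k + 1) := by
    -- The identity is known only at values `τ²` with `τ` real; the squares of natural numbers are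
    -- infinitely many such values.
    refine Polynomial.eq_of_infinite_eval_eq _ _ (Set.infinite_of_injective_forall_mem
      (f := fun n : ℕ => (n : ℂ) ^ 2) ?_ fun n => ?_)
    · intro a b hab
      simp only at hab
      have : a ^ 2 = b ^ 2 := by exact_mod_cast hab
      exact Nat.pow_left_injective two_ne_zero this
    · have := integral_rotation_identity (k + 1) n
      simpa [Polynomial.eval_finsetSum] using this
  have hcoeff := congrArg (fun p => p.coeff 1) hpoly
  simp only [Polynomial.finsetSum_coeff, Polynomial.coeff_C_mul, Polynomial.coeff_X_pow,
    mul_ite, mul_one, mul_zero, Polynomial.coeff_one_add_X_pow] at hcoeff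
  rw [Finset.sum_ite_eq, if_pos (by simp)] at hcoeff
  have hJ : J 1 = I₁ - ∫ g : SU2, (g.1 0 0 * g.1 1 1) ^ k ∂(normalizedHaar SU2) := by
    have e := continuous_entry
    have hc (m : ℕ) : Continuous fun g : SU2 => (g.1 0 0 * g.1 1 1) ^ m :=
      ((e 0 0).mul (e 1 1)).pow m
    rw [hI₁, ← integral_sub (integrable_normalizedHaar (hc _)) (integrable_normalizedHaar (hc _))]
    refine integral_congr_ae (.of_forall fun g => ?_)
    simp only [pow_one, Nat.add_sub_cancel, (entry_relations g).2.2]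
    ring
  rw [hJ, Nat.choose_one_right] at hcoeff
  have hk : (k + 1 : ℂ) ≠ 0 := Nat.cast_add_one_ne_zero k
  push_cast at hcoeff
  refine mul_left_cancel₀ hk ?_
  linear_combination -hcoeff

theorem integral_pow_eq (k : ℕ) :
    ∫ g : SU2, (g.1 0 0 * g.1 1 1) ^ k ∂(normalizedHaar SU2) = 1 / ((k : ℂ) + 1) := by
  induction k with
  | zero => simp
  | succ k ih =>
    have h := integral_pow_succ k
    have h1 : (k + 1 : ℂ) ≠ 0 := Nat.cast_add_one_ne_zero k
    have h2 : (k + 1 + 1 : ℂ) ≠ 0 := by exact_mod_cast Nat.succ_ne_zero (k + 1)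
    rw [ih, mul_one_div_cancel h1] at h
    push_cast
    rw [eq_div_iff h2]
    linear_combination h

/-- The function `g₀₀ g₁₁ = |g₀₀|²` is uniformly distributed on `[0, 1]`. -/
theorem integral_eval_eq_unitIntegral (q : Polynomial ℂ) :
    ∫ g : SU2, q.eval (g.1 0 0 * g.1 1 1) ∂(normalizedHaar SU2) = unitIntegral q := by
  simp only [Polynomial.eval_eq_sum, Polynomial.sum, unitIntegral]
  have hint (k : ℕ) : Integrable (fun g : SU2 => q.coeff k * (g.1 0 0 * g.1 1 1) ^ k)
      (normalizedHaar SU2) := integrable_normalizedHaar (continuous_const.mul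
    (((continuous_entry 0 0).mul (continuous_entry 1 1)).pow k))
  rw [integral_finsetSum _ fun k _ => hint k]
  refine Finset.sum_congr rfl fun k _ => ?_
  rw [integral_const_mul, integral_pow_eq, mul_one_div]

end Integral

/-! ### Matrix elements as coefficients of generating polynomials -/

section MatrixElement

open Polynomial

variable {R S : Type*} [CommRing R] [CommRing S]

/-- The generating polynomial `(a + c X) ^ r * (b + e X) ^ q` of a column of matrix elements. -/
noncomputable def genPoly (r q : ℕ) (a b c e : R) : R[X] := (C a + C c * X) ^ r * (C b + C e * X) ^ q

theorem genPoly_map (φ : R →+* S) (r q : ℕ) (a b c e : R) :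
    (genPoly r q a b c e).map φ = genPoly r q (φ a) (φ b) (φ c) (φ e) := by
  simp [genPoly]

theorem coeff_linear_pow (a c : R) (n i : ℕ) :
    ((C a + C c * X) ^ n).coeff i = c ^ i * a ^ (n - i) * n.choose i := by
  have : (C a + C c * X) ^ n = ∑ k ∈ Finset.range (n + 1),
      C (c ^ k * a ^ (n - k) * n.choose k) * X ^ k := by
    rw [add_comm, add_pow]
    refine Finset.sum_congr rfl fun k _ => ?_
    simp only [mul_pow, map_mul, map_pow, map_natCast]
    ring
  rw [this]
  simp only [finsetSum_coeff, coeff_C_mul_X_pow]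
  rw [Finset.sum_ite_eq]
  split_ifs with h
  · rfl
  · rw [Nat.choose_eq_zero_of_lt (by simpa using h)]
    simp

theorem coeff_genPoly (r q p : ℕ) (a b c e : R) :
    (genPoly r q a b c e).coeff p = ∑ x ∈ Finset.HasAntidiagonal.antidiagonal p,
      c ^ x.1 * a ^ (r - x.1) * r.choose x.1 * (e ^ x.2 * b ^ (q - x.2) * q.choose x.2) := by
  simp only [genPoly, coeff_mul, coeff_linear_pow]

/-- The coefficient of `X ^ p` is homogeneous of degree `p` in `(c, e)` and of degree `r + q - p` in
`(a, b)`. The factor `u ^ p` on the left avoids this subtraction. -/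
theorem coeff_genPoly_row (r q p : ℕ) (a b c e u v : R) :
    (genPoly r q (u * a) (u * b) (v * c) (v * e)).coeff p * u ^ p =
      u ^ (r + q) * v ^ p * (genPoly r q a b c e).coeff p := by
  rw [coeff_genPoly, coeff_genPoly, Finset.sum_mul, Finset.mul_sum]
  refine Finset.sum_congr rfl fun x hx => ?_
  obtain ⟨i, j⟩ := x
  obtain rfl := Finset.HasAntidiagonal.mem_antidiagonal.mp hx
  simp only
  rcases lt_or_ge r i with hi | hi
  · simp [Nat.choose_eq_zero_of_lt hi]
  rcases lt_or_ge q j with hj | hj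
  · simp [Nat.choose_eq_zero_of_lt hj]
  obtain ⟨k, rfl⟩ := Nat.exists_eq_add_of_le hi
  obtain ⟨l, rfl⟩ := Nat.exists_eq_add_of_le hj
  simp only [Nat.add_sub_cancel_left, mul_pow, pow_add]
  ring

theorem coeff_genPoly_col (r q p : ℕ) (a b c e u v : R) :
    (genPoly r q (u * a) (v * b) (u * c) (v * e)).coeff p =
      u ^ r * v ^ q * (genPoly r q a b c e).coeff p := by
  have : genPoly r q (u * a) (v * b) (u * c) (v * e) =
      C (u ^ r * v ^ q) * genPoly r q a b c e := by
    have h1 : C (u * a) + C (u * c) * X = C u * (C a + C c * X) := by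
      simp only [map_mul]; ring
    have h2 : C (v * b) + C (v * e) * X = C v * (C b + C e * X) := by
      simp only [map_mul]; ring
    rw [genPoly, genPoly, h1, h2, mul_pow, mul_pow]
    simp only [map_mul, map_pow]
    ring
  rw [this, coeff_C_mul]

namespace SpinIndex

/-- The left torus weight `-2m`. -/
noncomputable def leftWeight (I : SpinIndex) : ℤ := I.twoSpin - 2 * (I.row : ℕ)

/-- The right torus weight `-2n`. -/
noncomputable def rightWeight (I : SpinIndex) : ℤ := I.twoSpin - 2 * (I.col : ℕ)

theorem leftWeight_cast (I : SpinIndex) : (I.leftWeight : ℚ) = -2 * I.m := by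
  simp [leftWeight, m, l]; ring

theorem rightWeight_cast (I : SpinIndex) : (I.rightWeight : ℚ) = -2 * I.n := by
  simp [rightWeight, n, l]; ring

end SpinIndex

theorem normFactor_ne_zero (d : ℕ) (p : Fin (d + 1)) : normFactor d p ≠ 0 := by
  rw [normFactor]
  positivity

/-- Setting `x₀ = 1` and `x₁ = X` turns the basis vectors into multiples of distinct powers of `X`,
so the matrix element can be read off as a coefficient. -/
theorem matrixElement_eq (I : SpinIndex) (g : SU2) :
    matrixElement I g =
      ((normFactor I.twoSpin I.row / normFactor I.twoSpin I.col : ℝ) : ℂ) *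
        (genPoly (I.twoSpin - I.col) I.col (g.1 0 0) (g.1 0 1) (g.1 1 0) (g.1 1 1)).coeff I.row := by
  obtain ⟨d, p, q⟩ := I
  have h := congrArg (MvPolynomial.aeval (R := ℂ) ![(1 : ℂ[X]), X]) (polyRep_basisVec d q g)
  have hL : MvPolynomial.aeval (R := ℂ) ![(1 : ℂ[X]), X] (polyRep g (basisVec d q)) =
      C ((normFactor d q : ℂ)⁻¹) *
        genPoly (d - q) q (g.1 0 0) (g.1 0 1) (g.1 1 0) (g.1 1 1) := by
    have : polyRep g (basisVec d q) = MvPolynomial.aeval (fun j : Fin 2 =>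
      ∑ i : Fin 2, MvPolynomial.C (g.1 i j) * MvPolynomial.X i) (basisVec d q) := rfl
    rw [this, basisVec, MvPolynomial.aeval_monomial, Finsupp.prod_fintype _ _ (by simp)]
    simp [expo, genPoly, Fin.sum_univ_two, MvPolynomial.algebraMap_eq, Polynomial.algebraMap_eq]
  have hR (p' : Fin (d + 1)) : MvPolynomial.aeval (R := ℂ) ![(1 : ℂ[X]), X] (basisVec d p') =
      C ((normFactor d p' : ℂ)⁻¹) * X ^ (p' : ℕ) := by
    rw [basisVec, MvPolynomial.aeval_monomial, Finsupp.prod_fintype _ _ (by simp)]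
    simp [expo, Polynomial.algebraMap_eq]
  rw [hL, map_sum] at h
  simp only [map_smul, hR] at h
  have hc := congrArg (fun u => u.coeff (p : ℕ)) h
  simp only [coeff_C_mul, finsetSum_coeff, coeff_smul, coeff_X_pow, smul_eq_mul] at hc
  rw [Finset.sum_eq_single p (fun b _ hb => by
    rw [if_neg (fun h => hb (Fin.ext h.symm)), mul_zero, mul_zero]) (by simp), if_pos rfl] at hc
  have hp : (normFactor d p : ℂ) ≠ 0 := Complex.ofReal_ne_zero.mpr (normFactor_ne_zero d p)
  have hq : (normFactor d q : ℂ) ≠ 0 := Complex.ofReal_ne_zero.mpr (normFactor_ne_zero d q)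
  push_cast
  field_simp at hc ⊢
  linear_combination -hc

theorem continuous_matrixElement (I : SpinIndex) : Continuous (matrixElement I) := by
  have e := continuous_entry
  have : matrixElement I = _ := funext (matrixElement_eq I)
  rw [this]
  simp only [coeff_genPoly]
  refine continuous_const.mul (continuous_finsetSum _ fun x _ => ?_)
  exact ((((e 1 0).pow _).mul ((e 0 0).pow _)).mul continuous_const).mul
    ((((e 1 1).pow _).mul ((e 0 1).pow _)).mul continuous_const)

theorem matrixElement_torus_mul (I : SpinIndex) (z : Circle) (g : SU2) :
    matrixElement I (torus z * g) = (z : ℂ) ^ I.leftWeight * matrixElement I g := by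
  have h0 : (z : ℂ) ≠ 0 := Circle.coe_ne_zero z
  simp only [matrixElement_eq, torus_mul_apply_zero, torus_mul_apply_one]
  have h := coeff_genPoly_row (I.twoSpin - I.col) I.col I.row (g.1 0 0) (g.1 0 1) (g.1 1 0)
    (g.1 1 1) (z : ℂ) ((z : ℂ)⁻¹)
  rw [Nat.sub_add_cancel I.col.is_le] at h
  have hz : (z : ℂ) ^ I.leftWeight = (z : ℂ) ^ I.twoSpin * ((z : ℂ)⁻¹) ^ (I.row : ℕ) *
      ((z : ℂ)⁻¹) ^ (I.row : ℕ) := by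
    rw [SpinIndex.leftWeight, zpow_sub₀ h0, zpow_natCast, two_mul, zpow_add₀ h0, zpow_natCast,
      div_eq_mul_inv, mul_inv, inv_pow, mul_assoc]
  rw [hz]
  have hpow : (z : ℂ) ^ (I.row : ℕ) * ((z : ℂ)⁻¹) ^ (I.row : ℕ) = 1 := by
    rw [← mul_pow, mul_inv_cancel₀ h0, one_pow]
  set Y := (genPoly (I.twoSpin - I.col) I.col (z * g.1 0 0) (z * g.1 0 1) ((z : ℂ)⁻¹ * g.1 1 0)
    ((z : ℂ)⁻¹ * g.1 1 1)).coeff I.row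
  linear_combination ((normFactor I.twoSpin I.row / normFactor I.twoSpin I.col : ℝ) : ℂ) *
    ((z : ℂ)⁻¹) ^ (I.row : ℕ) * h -
    ((normFactor I.twoSpin I.row / normFactor I.twoSpin I.col : ℝ) : ℂ) * Y * hpow

theorem matrixElement_mul_torus (I : SpinIndex) (z : Circle) (g : SU2) :
    matrixElement I (g * torus z) = (z : ℂ) ^ I.rightWeight * matrixElement I g := by
  have h0 : (z : ℂ) ≠ 0 := Circle.coe_ne_zero z
  simp only [matrixElement_eq, mul_torus_apply_zero, mul_torus_apply_one, coeff_genPoly_col]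
  have hz : (z : ℂ) ^ I.rightWeight =
      (z : ℂ) ^ (I.twoSpin - (I.col : ℕ)) * ((z : ℂ)⁻¹) ^ (I.col : ℕ) := by
    rw [inv_pow, ← zpow_natCast, ← zpow_natCast, ← zpow_neg, ← zpow_add₀ h0,
      Nat.cast_sub I.col.is_le, SpinIndex.rightWeight]
    congr 1
    ring
  rw [hz]
  ring

theorem matrixElement_im_eq_zero (I : SpinIndex) {g : SU2} (hg : ∀ i j, ∃ x : ℝ, g.1 i j = x) :
    (matrixElement I g).im = 0 := by
  choose x hx using hg
  have : genPoly (I.twoSpin - I.col) I.col ((x 0 0 : ℝ) : ℂ) (x 0 1 : ℝ) (x 1 0 : ℝ) (x 1 1 : ℝ) =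
      (genPoly (I.twoSpin - I.col) I.col (x 0 0) (x 0 1) (x 1 0) (x 1 1)).map Complex.ofRealHom :=
    by rw [genPoly_map]; rfl
  rw [matrixElement_eq, hx, hx, hx, hx, this, coeff_map, Complex.ofRealHom_eq_coe,
    ← Complex.ofReal_mul, Complex.ofReal_im]

/-- The matrix element at a rotation, up to a nonzero factor, as a polynomial in the tangent. -/
noncomputable def rotationPoly (I : SpinIndex) : ℂ[X] :=
  (genPoly (I.twoSpin - I.col) I.col (1 : ℂ[X]) X (-X) 1).coeff I.row

theorem eval_rotationPoly (I : SpinIndex) (t : ℂ) : (rotationPoly I).eval t =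
    (genPoly (I.twoSpin - I.col) I.col 1 t (-t) 1).coeff I.row := by
  have := congrArg (fun u => u.coeff I.row) (genPoly_map (evalRingHom t) (I.twoSpin - I.col) I.col
    (1 : ℂ[X]) X (-X) 1)
  simpa [rotationPoly] using this

/-- At `t = i` the matrix with rows `(1, t)` and `(-t, 1)` is singular. The generating polynomial
becomes `i ^ q * (1 - i X) ^ (2ℓ)`, where `q = ℓ + n`, and its coefficients up to degree `2ℓ` are
all nonzero. -/
theorem rotationPoly_ne_zero (I : SpinIndex) : rotationPoly I ≠ 0 := by
  intro h
  have h1 := eval_rotationPoly I Complex.I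
  have h2 : genPoly (I.twoSpin - I.col) I.col 1 Complex.I (-Complex.I) 1 =
      C (Complex.I ^ (I.col : ℕ)) * (C 1 + C (-Complex.I) * X) ^ I.twoSpin := by
    have : C Complex.I + C 1 * X = C Complex.I * (C 1 + C (-Complex.I) * X) := by
      have hI : C Complex.I * C Complex.I = (-1 : ℂ[X]) := by
        rw [← C_mul, Complex.I_mul_I]; simp
      simp only [C_neg, C_1]
      linear_combination X * hI
    rw [genPoly, this, mul_pow, C_pow]
    rw [← pow_sub_mul_pow (C 1 + C (-Complex.I) * X) I.col.is_le]
    ring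
  rw [h, eval_zero, h2, coeff_C_mul, coeff_linear_pow] at h1
  have h3 : (I.twoSpin.choose I.row : ℂ) ≠ 0 :=
    Nat.cast_ne_zero.mpr (Nat.choose_pos I.row.is_le).ne'
  simp [h3] at h1

theorem matrixElement_rotation (I : SpinIndex) (τ : ℝ) :
    matrixElement I (rotation τ) =
      ((normFactor I.twoSpin I.row / normFactor I.twoSpin I.col : ℝ) : ℂ) *
        ((rotationScale τ : ℂ) ^ I.twoSpin * (rotationPoly I).eval (τ : ℂ)) := by
  have h := coeff_genPoly_col (I.twoSpin - I.col) I.col I.row (1 : ℂ) τ (-τ) 1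
    (rotationScale τ : ℂ) (rotationScale τ)
  rw [matrixElement_eq, rotation_val, eval_rotationPoly]
  simp only [mul_one, mul_neg, ← pow_add, Nat.sub_add_cancel I.col.is_le] at h
  simp [← h]

/-- Finitely many matrix elements have a common point at which none of them vanishes. -/
theorem exists_matrixElement_ne_zero {ι : Type*} [Fintype ι] (I : ι → SpinIndex) :
    ∃ g, ∀ i, matrixElement (I i) g ≠ 0 := by
  have hprod : ∏ i, rotationPoly (I i) ≠ 0 :=
    Finset.prod_ne_zero_iff.mpr fun i _ => rotationPoly_ne_zero (I i)
  obtain ⟨τ, hτ⟩ : ∃ τ : ℝ, (∏ i, rotationPoly (I i)).eval (τ : ℂ) ≠ 0 := by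
    by_contra! hall
    exact hprod (eq_zero_of_infinite_isRoot _ (Set.infinite_of_injective_forall_mem
      Complex.ofReal_injective hall))
  refine ⟨rotation τ, fun i => ?_⟩
  rw [matrixElement_rotation]
  rw [eval_prod] at hτ
  refine mul_ne_zero (Complex.ofReal_ne_zero.mpr (div_ne_zero (normFactor_ne_zero _ _)
    (normFactor_ne_zero _ _))) (mul_ne_zero (pow_ne_zero _ (rotationScale_ne_zero τ)) ?_)
  exact Finset.prod_ne_zero_iff.mp hτ i (Finset.mem_univ i)

/-- The shifted Legendre polynomial, as a polynomial in `g₀₀ g₁₁`. -/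
noncomputable def legendrePoly (ℓ : ℕ) : ℂ[X] :=
  ∑ x ∈ Finset.HasAntidiagonal.antidiagonal ℓ, C ((ℓ.choose x.1 * ℓ.choose x.2 : ℕ) : ℂ) *
    ((X - C 1) ^ x.1 * X ^ x.2)

theorem natDegree_legendrePoly_term {ℓ : ℕ} {x : ℕ × ℕ} (hx : x ∈ Finset.HasAntidiagonal.antidiagonal ℓ) :
    ((X - C (1 : ℂ)) ^ x.1 * X ^ x.2).Monic ∧ ((X - C (1 : ℂ)) ^ x.1 * X ^ x.2).natDegree = ℓ := by
  have h1 : ((X - C (1 : ℂ)) ^ x.1).Monic := (monic_X_sub_C 1).pow _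
  have h2 : ((X : ℂ[X]) ^ x.2).Monic := monic_X_pow _
  refine ⟨h1.mul h2, ?_⟩
  rw [h1.natDegree_mul h2, natDegree_pow, natDegree_X_sub_C, natDegree_X_pow, mul_one]
  exact Finset.HasAntidiagonal.mem_antidiagonal.mp hx

theorem natDegree_legendrePoly_le (ℓ : ℕ) : (legendrePoly ℓ).natDegree ≤ ℓ :=
  natDegree_sum_le_of_forall_le _ _ fun _ hx =>
    (natDegree_C_mul_le _ _).trans (natDegree_legendrePoly_term hx).2.le

/-- Every term is a multiple of a monic polynomial of degree `ℓ`, so by Vandermonde's identity the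
top coefficient is the central binomial coefficient. -/
theorem coeff_legendrePoly_ne_zero (ℓ : ℕ) : (legendrePoly ℓ).coeff ℓ ≠ 0 := by
  have : (legendrePoly ℓ).coeff ℓ = ((ℓ + ℓ).choose ℓ : ℕ) := by
    rw [legendrePoly, finsetSum_coeff, Nat.add_choose_eq, Nat.cast_sum]
    refine Finset.sum_congr rfl fun x hx => ?_
    obtain ⟨hm, hd⟩ := natDegree_legendrePoly_term hx
    have h1 : ((X - C (1 : ℂ)) ^ x.1 * X ^ x.2).coeff ℓ = 1 := by
      rw [← hd]; exact hm.coeff_natDegree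
    rw [coeff_C_mul, h1, mul_one]
  rw [this]
  exact Nat.cast_ne_zero.mpr (Nat.choose_pos (by omega)).ne'

/-- In weight `(0, 0)` the exponents pair up into powers of `g₀₁ g₁₀` and `g₀₀ g₁₁`, and the
determinant rewrites the former as `g₀₀ g₁₁ - 1`. -/
theorem matrixElement_eq_legendrePoly {I : SpinIndex} {ℓ : ℕ} (hd : I.twoSpin = 2 * ℓ)
    (hrow : (I.row : ℕ) = ℓ) (hcol : (I.col : ℕ) = ℓ) (g : SU2) :
    matrixElement I g = (legendrePoly ℓ).eval (g.1 0 0 * g.1 1 1) := by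
  have hrc : I.row = I.col := Fin.ext (hrow.trans hcol.symm)
  have hsub : 2 * ℓ - ℓ = ℓ := by omega
  rw [matrixElement_eq, hrc, div_self (normFactor_ne_zero _ _), Complex.ofReal_one, one_mul, hcol,
    hd, hsub, coeff_genPoly, legendrePoly, eval_finsetSum]
  refine Finset.sum_congr rfl fun x hx => ?_
  have hx' := Finset.HasAntidiagonal.mem_antidiagonal.mp hx
  have h1 : ℓ - x.1 = x.2 := by omega
  have h2 : ℓ - x.2 = x.1 := by omega
  simp only [h1, h2, eval_mul, eval_pow, eval_sub, eval_X, eval_C, Nat.cast_mul]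
  rw [← (entry_relations g).2.2, mul_pow, mul_pow]
  ring

end MatrixElement

/-! ### Powers of a combination of matrix elements -/

section Powers

variable {ι : Type*} [Fintype ι] (I : ι → SpinIndex) (A : ι → ℂ)

/-- A monomial in matrix elements. -/
noncomputable def elementMonomial (k : ι → ℕ) (g : SU2) : ℂ := ∏ i, matrixElement (I i) g ^ k i

theorem continuous_elementMonomial (k : ι → ℕ) : Continuous (elementMonomial I k) :=
  continuous_finsetProd _ fun i _ => (continuous_matrixElement (I i)).pow (k i)

theorem elementMonomial_torus_mul (k : ι → ℕ) (z : Circle) (g : SU2) :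
    elementMonomial I k (torus z * g) =
      (z : ℂ) ^ (∑ i, k i * (I i).leftWeight) * elementMonomial I k g := by
  have hz (s : Finset ι) : (z : ℂ) ^ (∑ i ∈ s, k i * (I i).leftWeight) =
      ∏ i ∈ s, ((z : ℂ) ^ (I i).leftWeight) ^ k i := by
    classical
    induction s using Finset.induction_on with
    | empty => simp
    | insert a s ha ih =>
      rw [Finset.sum_insert ha, Finset.prod_insert ha, zpow_add₀ (Circle.coe_ne_zero z), ih,
        mul_comm (k a : ℤ), zpow_mul, zpow_natCast]
  simp only [elementMonomial, matrixElement_torus_mul, mul_pow, Finset.prod_mul_distrib, hz]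

theorem elementMonomial_mul_torus (k : ι → ℕ) (z : Circle) (g : SU2) :
    elementMonomial I k (g * torus z) =
      (z : ℂ) ^ (∑ i, k i * (I i).rightWeight) * elementMonomial I k g := by
  have hz (s : Finset ι) : (z : ℂ) ^ (∑ i ∈ s, k i * (I i).rightWeight) =
      ∏ i ∈ s, ((z : ℂ) ^ (I i).rightWeight) ^ k i := by
    classical
    induction s using Finset.induction_on with
    | empty => simp
    | insert a s ha ih =>
      rw [Finset.sum_insert ha, Finset.prod_insert ha, zpow_add₀ (Circle.coe_ne_zero z), ih,
        mul_comm (k a : ℤ), zpow_mul, zpow_natCast]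
  simp only [elementMonomial, matrixElement_mul_torus, mul_pow, Finset.prod_mul_distrib, hz]

theorem sum_leftWeight_cast (k : ι → ℕ) :
    ((∑ i, k i * (I i).leftWeight : ℤ) : ℚ) = -2 * ∑ i, k i * (I i).m := by
  push_cast
  rw [Finset.mul_sum]
  refine Finset.sum_congr rfl fun i _ => ?_
  rw [SpinIndex.leftWeight_cast]
  ring

theorem sum_rightWeight_cast (k : ι → ℕ) :
    ((∑ i, k i * (I i).rightWeight : ℤ) : ℚ) = -2 * ∑ i, k i * (I i).n := by
  push_cast
  rw [Finset.mul_sum]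
  refine Finset.sum_congr rfl fun i _ => ?_
  rw [SpinIndex.rightWeight_cast]
  ring

/-- The multinomial expansion of the integral of a power. -/
theorem integral_pow_mul_eq_sum [DecidableEq ι] {h : SU2 → ℂ} (hh : Continuous h) (P : ℕ) :
    ∫ g, (∑ i, A i * matrixElement (I i) g) ^ P * h g ∂(normalizedHaar SU2) =
      ∑ k ∈ Finset.piAntidiag Finset.univ P,
        ((Nat.multinomial Finset.univ k : ℂ) * ∏ i, A i ^ k i) *
          ∫ g, elementMonomial I k g * h g ∂(normalizedHaar SU2) := by
  have hexp (g : SU2) : (∑ i, A i * matrixElement (I i) g) ^ P * h g =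
      ∑ k ∈ Finset.piAntidiag Finset.univ P,
        ((Nat.multinomial Finset.univ k : ℂ) * ∏ i, A i ^ k i) *
          (elementMonomial I k g * h g) := by
    rw [Finset.sum_pow_eq_sum_piAntidiag, Finset.sum_mul]
    refine Finset.sum_congr rfl fun k _ => ?_
    simp only [elementMonomial, mul_pow, Finset.prod_mul_distrib]
    ring
  simp only [hexp]
  have hint (k : ι → ℕ) : Integrable (fun g => ((Nat.multinomial Finset.univ k : ℂ) *
      ∏ i, A i ^ k i) * (elementMonomial I k g * h g)) (normalizedHaar SU2) :=
    (integrable_normalizedHaar ((continuous_elementMonomial I k).mul hh)).const_mul _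
  rw [integral_finsetSum _ fun k _ => hint k]
  simp only [integral_const_mul]

/-- If a linear functional is positive on all weights `(m_i, n_i)`, then the powers of `f` are
eventually orthogonal to every `SU(2)`-finite function. -/
theorem eventually_integral_eq_zero_of_separated {α β c : ℚ} (hc : 0 < c)
    (hsep : ∀ i, c ≤ α * (I i).m + β * (I i).n) {h : SU2 → ℂ} (hh : IsGFinite h) :
    ∀ᶠ P : ℕ in atTop,
      ∫ g, (∑ i, A i * matrixElement (I i) g) ^ P * h g ∂(normalizedHaar SU2) = 0 := by
  classical
  have hζ := generator_zpow_injective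
  have hζ0 : (generator : ℂ) ≠ 0 := Circle.coe_ne_zero _
  obtain ⟨N₁, hN₁⟩ := hh.exists_left_weight_bound (torus generator) hζ0 hζ
  obtain ⟨N₂, hN₂⟩ := hh.exists_right_weight_bound (torus generator) hζ0 hζ
  -- A monomial that pairs nontrivially with `h` has weights at most `N₁` and `N₂` in absolute
  -- value, while separation forces `2 c P ≤ |α| N₁ + |β| N₂`. The bound on `P` disregards the
  -- factor 2.
  obtain ⟨P₀, hP₀⟩ := exists_nat_gt ((|α| * N₁ + |β| * N₂) / c)
  filter_upwards [eventually_ge_atTop P₀] with P hP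
  rw [integral_pow_mul_eq_sum I A hh.1]
  refine Finset.sum_eq_zero fun k hk => ?_
  rw [Finset.mem_piAntidiag] at hk
  set w₁ := ∑ i, k i * (I i).leftWeight with hw₁
  set w₂ := ∑ i, k i * (I i).rightWeight with hw₂
  by_cases h1 : N₁ < w₁.natAbs
  · rw [hN₁ _ (continuous_elementMonomial I k) w₁ (elementMonomial_torus_mul I k _) h1, mul_zero]
  by_cases h2 : N₂ < w₂.natAbs
  · rw [hN₂ _ (continuous_elementMonomial I k) w₂ (elementMonomial_mul_torus I k _) h2, mul_zero]
  exfalso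
  have hsum : c * P ≤ α * (∑ i, k i * (I i).m) + β * ∑ i, k i * (I i).n := by
    rw [← hk.1, Nat.cast_sum, Finset.mul_sum, Finset.mul_sum, Finset.mul_sum,
      ← Finset.sum_add_distrib]
    refine Finset.sum_le_sum fun i _ => ?_
    have := mul_le_mul_of_nonneg_right (hsep i) (Nat.cast_nonneg (α := ℚ) (k i))
    linarith
  have e1 : (w₁ : ℚ) = -2 * ∑ i, k i * (I i).m := sum_leftWeight_cast I k
  have e2 : (w₂ : ℚ) = -2 * ∑ i, k i * (I i).n := sum_rightWeight_cast I k
  have a1 : |(w₁ : ℚ)| ≤ N₁ := by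
    rw [← Int.cast_abs, Int.abs_eq_natAbs]; exact_mod_cast not_lt.mp h1
  have a2 : |(w₂ : ℚ)| ≤ N₂ := by
    rw [← Int.cast_abs, Int.abs_eq_natAbs]; exact_mod_cast not_lt.mp h2
  have b1 : -(α * w₁) ≤ |α| * N₁ := (neg_le_abs _).trans (by rw [abs_mul]; gcongr)
  have b2 : -(β * w₂) ≤ |β| * N₂ := (neg_le_abs _).trans (by rw [abs_mul]; gcongr)
  have hPc : (P₀ : ℚ) ≤ P := by exact_mod_cast hP
  have h3 : |α| * N₁ + |β| * N₂ < P * c := ((div_lt_iff₀ hc).mp hP₀).trans_le (by gcongr)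
  rw [e1] at b1
  rw [e2] at b2
  have : (0 : ℚ) ≤ |α| * N₁ + |β| * N₂ := by positivity
  linarith

/-- If the weights have a relation with coefficients `k i`, which is the only one of its degree,
then the corresponding even power of `f` has nonzero integral. -/
theorem integral_pow_ne_zero_of_unique_relation (hA : ∀ i, A i ≠ 0) {k : ι → ℕ}
    (hm : ∑ i, k i * (I i).m = 0) (hn : ∑ i, k i * (I i).n = 0)
    (huniq : ∀ k' : ι → ℕ, ∑ i, k' i = 2 * ∑ i, k i → ∑ i, k' i * (I i).m = 0 →
      ∑ i, k' i * (I i).n = 0 → k' = 2 * k) :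
    ∫ g, (∑ i, A i * matrixElement (I i) g) ^ (2 * ∑ i, k i) ∂(normalizedHaar SU2) ≠ 0 := by
  classical
  have hexp := integral_pow_mul_eq_sum I A (h := fun _ => 1) continuous_const (2 * ∑ i, k i)
  simp only [mul_one] at hexp
  rw [hexp, Finset.sum_eq_single (2 * k)]
  · have hsq (g : SU2) : elementMonomial I (2 * k) g = elementMonomial I k g ^ 2 := by
      rw [elementMonomial, elementMonomial, ← Finset.prod_pow]
      refine Finset.prod_congr rfl fun i _ => ?_
      rw [← pow_mul]
      congr 1
      simp [mul_comm]
    simp only [hsq]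
    obtain ⟨g₀, hg₀⟩ := exists_matrixElement_ne_zero I
    refine mul_ne_zero (mul_ne_zero ?_ ?_) (integral_sq_ne_zero (continuous_elementMonomial I k)
      (fun g => ?_) (g₀ := g₀) ?_)
    · exact Nat.cast_ne_zero.mpr (Nat.multinomial_pos _ _).ne'
    · exact Finset.prod_ne_zero_iff.mpr fun i _ => pow_ne_zero _ (hA i)
    -- Weight zero makes the monomial invariant under the torus on both sides, so it may be
    -- evaluated at a real matrix, where every matrix element is real.
    · obtain ⟨z, w, hreal⟩ := exists_torus_mul_real g
      have h1 : elementMonomial I k (torus z * g * torus w) = elementMonomial I k g := by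
        have e1 : (∑ i, k i * (I i).leftWeight : ℤ) = 0 := by
          have := sum_leftWeight_cast I k
          rw [hm, mul_zero] at this
          exact_mod_cast this
        have e2 : (∑ i, k i * (I i).rightWeight : ℤ) = 0 := by
          have := sum_rightWeight_cast I k
          rw [hn, mul_zero] at this
          exact_mod_cast this
        rw [elementMonomial_mul_torus, elementMonomial_torus_mul, e1, e2, zpow_zero, zpow_zero,
          one_mul, one_mul]
      rw [← h1]
      have h2 (i : ι) : matrixElement (I i) (torus z * g * torus w) =
          ((matrixElement (I i) (torus z * g * torus w)).re : ℂ) :=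
        Complex.ext rfl (by simp [matrixElement_im_eq_zero (I i) hreal])
      rw [elementMonomial, Finset.prod_congr rfl fun i _ => by rw [h2 i]]
      simp only [← Complex.ofReal_pow, ← Complex.ofReal_prod, Complex.ofReal_im]
    · exact Finset.prod_ne_zero_iff.mpr fun i _ => pow_ne_zero _ (hg₀ i)
  · intro k' hk' hne
    rw [Finset.mem_piAntidiag] at hk'
    have h0 : ∫ g, elementMonomial I k' g ∂(normalizedHaar SU2) = 0 := by
      by_cases h1 : (∑ i, k' i * (I i).leftWeight : ℤ) = 0
      · by_cases h2 : (∑ i, k' i * (I i).rightWeight : ℤ) = 0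
        · exfalso
          have e1 := sum_leftWeight_cast I k'
          have e2 := sum_rightWeight_cast I k'
          rw [h1] at e1
          rw [h2] at e2
          refine hne (huniq k' hk'.1 ?_ ?_)
          · simpa using e1
          · simpa using e2
        · exact integral_eq_zero_of_mul_right (generator_zpow_ne_one h2)
            (elementMonomial_mul_torus I k' generator)
      · exact integral_eq_zero_of_mul_left (generator_zpow_ne_one h1)
          (elementMonomial_torus_mul I k' generator)
    rw [h0, mul_zero]
  · intro h
    exfalso
    apply h
    rw [Finset.mem_piAntidiag]
    refine ⟨?_, fun i _ => Finset.mem_univ i⟩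
    simp [Finset.mul_sum]

/-- A nontrivial combination of matrix elements of weight `(0, 0)` has a power with nonzero
integral. -/
theorem exists_integral_pow_ne_zero_of_weight_zero [Nonempty ι] (hI : Function.Injective I)
    (hA : ∀ i, A i ≠ 0) (hm : ∀ i, (I i).m = 0) (hn : ∀ i, (I i).n = 0) :
    ∃ P : ℕ, 0 < P ∧
      ∫ g, (∑ i, A i * matrixElement (I i) g) ^ P ∂(normalizedHaar SU2) ≠ 0 := by
  have hrow (i : ι) : (I i).twoSpin = 2 * ((I i).row : ℕ) := by
    have := hm i
    rw [SpinIndex.m, SpinIndex.l] at this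
    have h2 : ((I i).twoSpin : ℚ) = 2 * ((I i).row : ℕ) := by linarith
    exact_mod_cast h2
  have hcol (i : ι) : (I i).twoSpin = 2 * ((I i).col : ℕ) := by
    have := hn i
    rw [SpinIndex.n, SpinIndex.l] at this
    have h2 : ((I i).twoSpin : ℚ) = 2 * ((I i).col : ℕ) := by linarith
    exact_mod_cast h2
  let q : Polynomial ℂ := ∑ i, Polynomial.C (A i) * legendrePoly (I i).row
  have hf (g : SU2) : ∑ i, A i * matrixElement (I i) g = q.eval (g.1 0 0 * g.1 1 1) := by
    simp only [q, Polynomial.eval_finsetSum, Polynomial.eval_mul, Polynomial.eval_C]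
    refine Finset.sum_congr rfl fun i _ => ?_
    rw [matrixElement_eq_legendrePoly (hrow i) rfl (by have := hrow i; have := hcol i; omega)]
  -- In weight `(0, 0)` the spin alone determines the index, so the Legendre polynomials have
  -- distinct degrees and the top one cannot cancel.
  have hinj (i j : ι) (hij : ((I i).row : ℕ) = (I j).row) : i = j := by
    apply hI
    have h1 : (I i).twoSpin = (I j).twoSpin := by
      have := hrow i; have := hrow j; omega
    have h2 : ((I i).col : ℕ) = (I j).col := by have := hcol i; have := hcol j; omega
    refine SpinIndex.ext h1 ?_ ?_
    · exact (Fin.heq_ext_iff (by rw [h1])).mpr hij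
    · exact (Fin.heq_ext_iff (by rw [h1])).mpr h2
  have hq : q ≠ 0 := by
    obtain ⟨i, -, hi⟩ := Finset.exists_max_image Finset.univ (fun i => ((I i).row : ℕ))
      Finset.univ_nonempty
    intro h0
    have h1 : q.coeff (I i).row = A i * (legendrePoly (I i).row).coeff (I i).row := by
      simp only [q, Polynomial.finsetSum_coeff, Polynomial.coeff_C_mul]
      refine Finset.sum_eq_single i (fun j _ hj => ?_) (fun h => absurd (Finset.mem_univ i) h)
      rw [Polynomial.coeff_eq_zero_of_natDegree_lt, mul_zero]
      refine (natDegree_legendrePoly_le _).trans_lt (lt_of_le_of_ne (hi j (Finset.mem_univ j)) ?_)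
      exact fun h => hj (hinj j i h)
    rw [h0, Polynomial.coeff_zero] at h1
    exact mul_ne_zero (hA i) (coeff_legendrePoly_ne_zero _) h1.symm
  obtain ⟨P, hP, hne⟩ := exists_unitIntegral_pow_ne_zero hq
  refine ⟨P, hP, ?_⟩
  simp only [hf, ← Polynomial.eval_pow, integral_eval_eq_unitIntegral]
  exact hne

end Powers

/-! ### Linear algebra of the weights -/

/-- Nonnegative rational numbers have a common denominator. -/
theorem exists_nat_mul_eq_natCast {ι : Type*} [Fintype ι] {y : ι → ℚ} (hy : ∀ i, 0 ≤ y i) :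
    ∃ N : ℕ, 0 < N ∧ ∃ k : ι → ℕ, ∀ i, (k i : ℚ) = N * y i := by
  refine ⟨∏ i, (y i).den, Finset.prod_pos fun i _ => (y i).pos, ?_⟩
  have (i : ι) : ∃ k : ℕ, (k : ℚ) = (∏ i, (y i).den : ℕ) * y i := by
    obtain ⟨c, hc⟩ := Finset.dvd_prod_of_mem (fun i => (y i).den) (Finset.mem_univ i)
    refine ⟨c * (y i).num.toNat, ?_⟩
    have h1 : (((y i).num.toNat : ℤ) : ℚ) = (y i).num := by
      rw [Int.toNat_of_nonneg (Rat.num_nonneg.mpr (hy i))]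
    have h2 : ((y i).den : ℚ) * y i = (y i).num := by rw [mul_comm]; exact Rat.mul_den_eq_num _
    rw [hc]
    push_cast at h1 ⊢
    rw [h1, ← h2]
    ring
  choose k hk using this
  exact ⟨k, hk⟩

/-- If the weights `(1, m_i, n_i)` are dependent but do not span a space of dimension two, then
they coincide. -/
theorem eq_of_det_eq_zero_of_rank_ne_two {K : Type*} [Field K] {a b : Fin 3 → K}
    (hdet : Matrix.det !![1, 1, 1; a 0, a 1, a 2; b 0, b 1, b 2] = 0)
    (hrank : Matrix.rank !![1, 1, 1; a 0, a 1, a 2; b 0, b 1, b 2] ≠ 2) (i j : Fin 3) :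
    a i = a j ∧ b i = b j := by
  set M := !![1, 1, 1; a 0, a 1, a 2; b 0, b 1, b 2] with hM
  have hcol (i : Fin 3) : M.col i = ![1, a i, b i] := by
    funext r
    fin_cases i <;> fin_cases r <;> rfl
  by_contra hne
  -- Two distinct columns with the same first entry 1 are independent, so the rank would be exactly
  -- 2.
  have hlin : LinearIndependent K ![M.col i, M.col j] := by
    rw [LinearIndependent.pair_iff]
    intro s t hst
    rw [hcol, hcol] at hst
    have h0 := congrFun hst 0
    have h1 := congrFun hst 1
    have h2 := congrFun hst 2
    simp at h0 h1 h2
    have ht : t = -s := by linear_combination h0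
    subst ht
    have e1 : s * (a i - a j) = 0 := by linear_combination h1
    have e2 : s * (b i - b j) = 0 := by linear_combination h2
    have hs : s = 0 := by
      by_contra hs
      exact hne ⟨sub_eq_zero.mp ((mul_eq_zero.mp e1).resolve_left hs),
        sub_eq_zero.mp ((mul_eq_zero.mp e2).resolve_left hs)⟩
    simp [hs]
  have hge : 2 ≤ M.rank := by
    have h1 := finrank_span_eq_card hlin
    rw [Matrix.rank_eq_finrank_span_cols, ← Fintype.card_fin 2, ← h1]
    refine Submodule.finrank_mono (Submodule.span_mono ?_)
    rintro _ ⟨r, rfl⟩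
    fin_cases r
    · exact ⟨i, rfl⟩
    · exact ⟨j, rfl⟩
  have hlt : M.rank ≠ 3 := by
    intro h3
    rw [Matrix.rank_eq_finrank_span_cols] at h3
    have : LinearIndependent K M.col :=
      linearIndependent_iff_card_eq_finrank_span.mpr (by rw [Fintype.card_fin]; exact h3.symm)
    have := Matrix.linearIndependent_cols_iff_isUnit.mp this
    rw [Matrix.isUnit_iff_isUnit_det, hdet] at this
    exact not_isUnit_zero this
  have hle : M.rank ≤ 3 := by simpa using M.rank_le_card_width
  omega

end Mathieu

/-! ### The case analysis on the position of the origin -/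

theorem mainTheorem3 (I : Fin 3 → Mathieu.SpinIndex) (hI : Function.Injective I)
    (A : Fin 3 → ℂ) (hA : ∀ i, A i ≠ 0)
    (hM : Matrix.rank !![1, 1, 1;
                         (I 0).m, (I 1).m, (I 2).m;
                         (I 0).n, (I 1).n, (I 2).n] ≠ 2) :
    Mathieu.MathieuHoldsFor
      (fun g : Mathieu.SU2 => ∑ i : Fin 3, A i * Mathieu.matrixElement (I i) g) := by
  intro hzero h hh
  by_cases hdet : Matrix.det !![1, 1, 1; (I 0).m, (I 1).m, (I 2).m;
      (I 0).n, (I 1).n, (I 2).n] = 0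
  · have hall := Mathieu.eq_of_det_eq_zero_of_rank_ne_two (a := fun i => (I i).m)
      (b := fun i => (I i).n) hdet hM
    by_cases hw : (I 0).m = 0 ∧ (I 0).n = 0
    · obtain ⟨P, hP, hne⟩ := Mathieu.exists_integral_pow_ne_zero_of_weight_zero I A hI hA
        (fun i => (hall i 0).1.trans hw.1) (fun i => (hall i 0).2.trans hw.2)
      exact absurd (hzero P hP) hne
    · refine Mathieu.eventually_integral_eq_zero_of_separated I A (α := (I 0).m) (β := (I 0).n)
        (c := (I 0).m ^ 2 + (I 0).n ^ 2) ?_ (fun i => ?_) hh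
      · refine lt_of_le_of_ne (by positivity) fun h0 => hw ?_
        have h1 := sq_nonneg (I 0).m
        have h2 := sq_nonneg (I 0).n
        exact ⟨pow_eq_zero_iff two_ne_zero |>.mp (by linarith),
          pow_eq_zero_iff two_ne_zero |>.mp (by linarith)⟩
      · have h1 : (I i).m = (I 0).m := (hall i 0).1
        have h2 : (I i).n = (I 0).n := (hall i 0).2
        rw [h1, h2, sq, sq]
  · set M := !![1, 1, 1; (I 0).m, (I 1).m, (I 2).m; (I 0).n, (I 1).n, (I 2).n] with hMdef
    have hu : IsUnit M.det := isUnit_iff_ne_zero.mpr hdet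
    -- Row `j` of `M⁻¹` is the `j`-th barycentric coordinate of the triangle, as an affine function;
    -- its constant term `M⁻¹ j 0` is the value at the origin.
    have hleft (j i : Fin 3) :
        M⁻¹ j 0 + M⁻¹ j 1 * (I i).m + M⁻¹ j 2 * (I i).n = if j = i then 1 else 0 := by
      have := congrFun (congrFun (Matrix.nonsing_inv_mul M hu) j) i
      rw [Matrix.mul_apply, Fin.sum_univ_three, Matrix.one_apply] at this
      rw [← this]
      fin_cases i <;> simp [hMdef]
    have hright (r : Fin 3) : M r 0 * M⁻¹ 0 0 + M r 1 * M⁻¹ 1 0 + M r 2 * M⁻¹ 2 0 =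
        if r = 0 then 1 else 0 := by
      have := congrFun (congrFun (Matrix.mul_nonsing_inv M hu) r) 0
      rwa [Matrix.mul_apply, Fin.sum_univ_three, Matrix.one_apply] at this
    by_cases hy : ∀ j, 0 ≤ M⁻¹ j 0
    · exfalso
      obtain ⟨N, hN, k, hk⟩ := Mathieu.exists_nat_mul_eq_natCast hy
      have hsum : ∑ i, k i = N := by
        have h0 := hright 0
        simp [hMdef] at h0
        have : ((∑ i, k i : ℕ) : ℚ) = N := by
          rw [Nat.cast_sum, Fin.sum_univ_three, hk, hk, hk]
          linear_combination (N : ℚ) * h0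
        exact_mod_cast this
      refine Mathieu.integral_pow_ne_zero_of_unique_relation I A hA (k := k) ?_ ?_ ?_
        (hzero (2 * ∑ i, k i) (by omega))
      · have h1 := hright 1
        simp [hMdef] at h1
        rw [Fin.sum_univ_three, hk, hk, hk]
        linear_combination (N : ℚ) * h1
      · have h1 := hright 2
        simp [hMdef] at h1
        rw [Fin.sum_univ_three, hk, hk, hk]
        linear_combination (N : ℚ) * h1
      -- Applying the barycentric coordinates to another relation of the same degree recovers each
      -- of its coefficients.
      · intro k' hk' hm hn
        funext j
        have hk'Q : ∑ i, (k' i : ℚ) = 2 * N := by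
          rw [← hsum]; exact_mod_cast hk'
        have h1 : ∑ i, (k' i : ℚ) * (M⁻¹ j 0 + M⁻¹ j 1 * (I i).m + M⁻¹ j 2 * (I i).n) = k' j := by
          simp [hleft]
        have h2 : ∑ i, (k' i : ℚ) * (M⁻¹ j 0 + M⁻¹ j 1 * (I i).m + M⁻¹ j 2 * (I i).n) =
            M⁻¹ j 0 * ∑ i, (k' i : ℚ) + M⁻¹ j 1 * (∑ i, k' i * (I i).m) +
              M⁻¹ j 2 * ∑ i, k' i * (I i).n := by
          simp only [Finset.mul_sum, ← Finset.sum_add_distrib]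
          exact Finset.sum_congr rfl fun i _ => by ring
        rw [h2, hk'Q, hm, hn] at h1
        have h3 : (k' j : ℚ) = 2 * k j := by
          rw [← h1, hk]; ring
        have h4 : k' j = 2 * k j := by exact_mod_cast h3
        simpa using h4
    · push Not at hy
      obtain ⟨j, hj⟩ := hy
      -- This barycentric coordinate is nonnegative on the three weights and negative at the origin,
      -- so its linear part is at least `-M⁻¹ j 0 > 0` on the weights.
      refine Mathieu.eventually_integral_eq_zero_of_separated I A (α := M⁻¹ j 1) (β := M⁻¹ j 2)
        (c := -M⁻¹ j 0) (by linarith) (fun i => ?_) hh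
      have h1 := hleft j i
      have h2 : (0 : ℚ) ≤ if j = i then 1 else 0 := by split_ifs <;> norm_num
      linarith
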